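/- Let $n,\ell,m_-,m_+$ be positive integers with $1\le m_\pm\le n-1$ and $\frac{n-1}{\ell}=\frac{m_-+m_+}{2}$; in particular this covers the case where $\ell$ is the number of distinct principal curvatures, and $m_-,m_+$ are the multiplicities, of an isoparametric hypersurface of the round sphere $\mathbb S^n$. Put $n_\pm:=(n-1)-m_\pm$ (the dimensions of the focal submanifolds) and $n_*:=\min\{n_-,n_+\}$, and let $$h(r)=\frac{n-1}{\ell}\cos r-\frac{m_+-m_-}{2}.$$ Let $\lambda>0$ and $1<p<\frac{n-n_*+2}{n-n_*-2}$, where the upper bound is read as $+\infty$ if $n-n_*=2$. Then for every $k\in\mathbb N$ there is a function $w_k\in C^2([0,\pi])$ with $$w_k''+\frac{h(r)}{\sin r}\,w_k'+\frac{\lambda}{\ell^2}\left(|w_k|^{p-1}w_k-w_k\right)=0\ \text{ on }(0,\pi),\qquad w_k'(0)=w_k'(\pi)=0,$$ which takes both positive and negative values on $[0,\pi]$, has at least $k$ isolated zeros in $[0,\pi]$, and has at least $k+1$ isolated critical points in $[0,\pi]$ (the end points $0$ and $\pi$ count as critical points; a zero or critical point is isolated if it is not an accumulation point of the set of all zeros,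 respectively all critical points, of $w_k$ in $[0,\pi]$). -/

import Mathlib

open Set Filter Topology

namespace NodalYamabe

noncomputable section

/-- Dimension of the focal submanifold of an isoparametric family in the `n`-sphere whose
associated principal curvature has multiplicity `m`, where `1 ≤ m ≤ n - 1`. -/
def focalDim (n m : ℕ) : ℕ := n - 1 - m

/-- `p` lies below the critical Sobolev exponent `(N + 2) / (N - 2)` of dimension `N`;
this exponent is `+∞` when `N ≤ 2`. -/
def BelowCriticalExponent (N : ℕ) (p : ℝ) : Prop :=
  2 < N → p < ((N : ℝ) + 2) / ((N : ℝ) - 2)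

/-- The coefficient `h(r) = ((n - 1) / ℓ) cos r - (m₊ - m₋) / 2`. -/
def coeffH (n ℓ mMinus mPlus : ℕ) (r : ℝ) : ℝ :=
  ((n : ℝ) - 1) / (ℓ : ℝ) * Real.cos r - ((mPlus : ℝ) - (mMinus : ℝ)) / 2

/-- `w` is a classical solution, `C²` up to the end points of `[0, π]`, of
`w'' + (h(r) / sin r) w' + (lam / ℓ²) (|w|^(p-1) w - w) = 0` with `w'(0) = w'(π) = 0`.
At the two end points, where `sin r = 0`, the derivatives are one-sided; the singular equation
itself is read at the points where `sin r ≠ 0`. -/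
structure IsSolution (n ℓ mMinus mPlus : ℕ) (lam p : ℝ) (w : ℝ → ℝ) : Prop where
  contDiffOn : ContDiffOn ℝ 2 w (Icc 0 Real.pi)
  ode : ∀ r ∈ Ioo 0 Real.pi,
    deriv (deriv w) r + coeffH n ℓ mMinus mPlus r / Real.sin r * deriv w r
      + lam / (ℓ : ℝ) ^ 2 * (|w r| ^ (p - 1) * w r - w r) = 0
  left : HasDerivWithinAt w 0 (Icc 0 Real.pi) 0
  right : HasDerivWithinAt w 0 (Icc 0 Real.pi) Real.pi

/-- `w` takes both a positive and a negative value on `[0, π]`. -/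
def SignChanging (w : ℝ → ℝ) : Prop :=
  (∃ a ∈ Icc 0 Real.pi, 0 < w a) ∧ ∃ b ∈ Icc 0 Real.pi, w b < 0

/-- The zeros of `w` in `[0, π]`. -/
def zeroSet (w : ℝ → ℝ) : Set ℝ := {r | r ∈ Icc 0 Real.pi ∧ w r = 0}

/-- The critical points of `w` in `[0, π]`, with one-sided derivatives at the end points. -/
def criticalSet (w : ℝ → ℝ) : Set ℝ :=
  {r | r ∈ Icc 0 Real.pi ∧ HasDerivWithinAt w 0 (Icc 0 Real.pi) r}

/-- The isolated points of a set of reals. -/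
def isolatedPoints (S : Set ℝ) : Set ℝ := {r | r ∈ S ∧ ¬ AccPt r (𝓟 S)}

end

end NodalYamabe

/-! In half angles the coefficient of `w'` is the logarithmic derivative of `sin (r/2) ^ m₋ * cos
(r/2) ^ m₊` (`coeffH_div_sin`). The equation is therefore `w'' + q w' + g(w) = 0`, and near each
pole it resembles a radial equation in dimension `m₋ + 1` or `m₊ + 1`. It is solved by shooting from
both poles towards `minimalAngle`, where `q` changes sign. Measured from its own pole, each half has
`q ≥ 0` (`isWeight_density`), so the energy decreases along solutions and gives global a priori
bounds.

For a nonzero initial value the phase point `w + i Q w'` never vanishes. It has a logarithm `L` that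
is continuous in the initial value (`IsWeight.exists_phaseLog_family`). At a zero of `w` the
argument has derivative `-1 / Q < 0`, so it crosses odd multiples of `π / 2` only downwards, and the
winding counts zeros. A small initial value gives a positive solution, hence little winding and a
small modulus. For a large initial value, a Pohozaev functional shows that the energy at a fixed
point near the pole tends to infinity; this is where subcriticality enters
(`IsWeight.exists_energy_large`). A Riccati argument turns large energy into zeros in any prescribed
interval near the pole (`IsWeight.exists_zero_of_energy_large`), so the winding is unbounded
(`IsWeight.exists_winding`).

Two halves fit together when their phases at the junction are complex conjugate. Requiring equal
real parts of the two logarithms and imaginary parts with sum `-2πK` gives two real equations for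
the two initial values. On a suitable rectangle, the small and large data fix enough signs along the
boundary to force a common root (`exists_zero_of_boundary_signs`, `exists_matching`). One of the two
arguments is then at most `-πK`, so that half has `K` zeros and takes a negative value.

Uniqueness makes interior zeros simple and interior critical points nondegenerate, hence both are
isolated. Rolle's theorem supplies critical points between consecutive zeros. -/

namespace NodalYamabe

/-- The nonlinearity `μ (|x|^(p-1) x - x)`. -/
noncomputable def nonlin (p μ x : ℝ) : ℝ := μ * (|x| ^ (p - 1) * x - x)

/-- The primitive of `nonlin p μ` that vanishes at the origin. -/
noncomputable def potential (p μ x : ℝ) : ℝ := μ * (|x| ^ (p + 1) / (p + 1) - x ^ 2 / 2)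

/-! ### Growth and regularity of the nonlinearity and its primitive. -/

section Nonlinearity

variable {p μ : ℝ}

theorem abs_rpow_add_one (hp : 1 < p) (x : ℝ) : |x| ^ (p + 1) = |x| ^ (p - 1) * x ^ 2 := by
  rcases eq_or_ne x 0 with rfl | hx
  · simp [Real.zero_rpow (by linarith : p + 1 ≠ 0)]
  · have h : p + 1 = (p - 1) + (2 : ℕ) := by push_cast; ring
    rw [h, Real.rpow_add_natCast (abs_ne_zero.2 hx), sq_abs]

theorem potential_eq (hp : 1 < p) (x : ℝ) :
    potential p μ x = μ * (x ^ 2 * (|x| ^ (p - 1) / (p + 1) - 1 / 2)) := by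
  rw [potential, abs_rpow_add_one hp]; ring

@[simp] theorem nonlin_zero : nonlin p μ 0 = 0 := by simp [nonlin]

theorem hasDerivAt_potential (hp : 1 < p) (x : ℝ) :
    HasDerivAt (potential p μ) (nonlin p μ x) x := by
  have h1 := hasDerivAt_abs_rpow x (p := p + 1) (by linarith)
  have h2 := ((h1.div_const (p + 1)).sub ((hasDerivAt_pow 2 x).div_const 2)).const_mul μ
  refine h2.congr_deriv ?_
  have : p + 1 ≠ 0 := by linarith
  have e : p + 1 - 2 = p - 1 := by ring
  rw [nonlin, e]
  field_simp
  push_cast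
  ring

theorem hasDerivAt_abs_rpow_mul (hp : 1 < p) (x : ℝ) :
    HasDerivAt (fun x : ℝ => |x| ^ (p - 1) * x) (p * |x| ^ (p - 1)) x := by
  rcases eq_or_ne x 0 with rfl | hx
  · rw [hasDerivAt_iff_tendsto_slope]
    have h0 : Tendsto (fun y : ℝ => |y| ^ (p - 1)) (𝓝[≠] 0) (𝓝 (p * |(0 : ℝ)| ^ (p - 1))) := by
      have : ContinuousAt (fun y : ℝ => |y| ^ (p - 1)) 0 :=
        (continuous_abs.continuousAt).rpow_const (Or.inr (by linarith))
      have h := this.tendsto.mono_left (nhdsWithin_le_nhds (s := {0}ᶜ))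
      have z : (0 : ℝ) ^ (p - 1) = 0 := Real.zero_rpow (by linarith)
      simpa [z] using h
    refine h0.congr' ?_
    filter_upwards [self_mem_nhdsWithin] with y hy
    have hy' : y ≠ 0 := hy
    simp [slope_def_field, hy']
  · have h1 := (((hasDerivAt_abs hx).rpow_const (p := p - 1)
      (Or.inl (abs_ne_zero.2 hx)))).mul (hasDerivAt_id x)
    refine h1.congr_deriv ?_
    have e : |x| ^ (p - 1) = |x| ^ (p - 1 - 1) * |x| := by
      rw [← Real.rpow_add_one (abs_ne_zero.2 hx)]; ring_nf
    have s : (SignType.sign x : ℝ) * x = |x| := sign_mul_self x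
    simp only [id, mul_one]
    calc _ = (p - 1) * |x| ^ (p - 1 - 1) * ((SignType.sign x : ℝ) * x) + |x| ^ (p - 1) := by ring
      _ = _ := by rw [s, e]; ring

theorem hasDerivAt_nonlin (hp : 1 < p) (x : ℝ) :
    HasDerivAt (nonlin p μ) (μ * (p * |x| ^ (p - 1) - 1)) x :=
  ((hasDerivAt_abs_rpow_mul hp x).sub (hasDerivAt_id x)).const_mul μ

theorem continuous_nonlin (hp : 1 < p) : Continuous (nonlin p μ) :=
  continuous_iff_continuousAt.2 fun x => (hasDerivAt_nonlin hp x).continuousAt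

theorem continuous_potential (hp : 1 < p) : Continuous (potential p μ) :=
  continuous_iff_continuousAt.2 fun x => (hasDerivAt_potential hp x).continuousAt

/-- `nonlin p μ` is Lipschitz on bounded intervals. -/
theorem exists_lipschitz_nonlin (hp : 1 < p) (hμ : 0 < μ) (M : ℝ) :
    ∃ K : ℝ, 0 < K ∧ ∀ x y : ℝ, |x| ≤ M → |y| ≤ M →
      |nonlin p μ x - nonlin p μ y| ≤ K * |x - y| := by
  refine ⟨μ * (p * |M| ^ (p - 1) + 1), by positivity, fun x y hx hy => ?_⟩
  have := Convex.norm_image_sub_le_of_norm_hasDerivWithin_le (s := Icc (-M) M)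
    (f := nonlin p μ) (f' := fun x => μ * (p * |x| ^ (p - 1) - 1))
    (C := μ * (p * |M| ^ (p - 1) + 1)) (x := y) (y := x)
    (fun z _ => (hasDerivAt_nonlin hp z).hasDerivWithinAt) ?_ (convex_Icc _ _)
    (abs_le.1 hy) (abs_le.1 hx)
  · simpa using this
  · intro z hz
    have hz' : |z| ≤ |M| := (abs_le.2 hz).trans (le_abs_self M)
    have h1 : |z| ^ (p - 1) ≤ |M| ^ (p - 1) :=
      Real.rpow_le_rpow (abs_nonneg z) hz' (by linarith)
    have h0 : 0 ≤ |z| ^ (p - 1) := by positivity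
    rw [Real.norm_eq_abs, abs_mul, abs_of_pos hμ]
    refine mul_le_mul_of_nonneg_left ?_ hμ.le
    rw [abs_le]
    constructor <;> nlinarith

theorem abs_nonlin_le (hp : 1 < p) (hμ : 0 < μ) {A x : ℝ} (hA : 1 ≤ A) (hx : |x| ≤ A) :
    |nonlin p μ x| ≤ μ * A ^ p := by
  have h1 : |x| ^ (p - 1) ≤ A ^ (p - 1) := Real.rpow_le_rpow (abs_nonneg x) hx (by linarith)
  have h2 : 1 ≤ A ^ (p - 1) := Real.one_le_rpow hA (by linarith)
  have h0 : 0 ≤ |x| ^ (p - 1) := by positivity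
  have e : A ^ p = A ^ (p - 1) * A := by
    rw [← Real.rpow_add_one (by linarith)]; ring_nf
  have e' : nonlin p μ x = μ * ((|x| ^ (p - 1) - 1) * x) := by rw [nonlin]; ring
  rw [e', abs_mul, abs_of_pos hμ, abs_mul, e]
  refine mul_le_mul_of_nonneg_left (mul_le_mul ?_ hx (abs_nonneg x) (by linarith)) hμ.le
  rw [abs_le]
  constructor <;> linarith

/-- Beyond some radius the potential is larger than anywhere closer to the origin. -/
theorem exists_potential_lt (hp : 1 < p) (hμ : 0 < μ) :
    ∃ C : ℝ, 1 ≤ C ∧ ∀ x y : ℝ, |y| < |x| → C ≤ |x| → potential p μ y < potential p μ x := by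
  -- Beyond this radius `|x| ^ (p - 1) / (p + 1) ≥ 1`, so the bracket in `potential_eq` is at least
  -- `1 / 2`. It also dominates the bracket at `y`.
  refine ⟨(p + 1) ^ (1 / (p - 1)), Real.one_le_rpow (by linarith)
    (by have : 0 < p - 1 := by linarith
        positivity), fun x y hyx hC => ?_⟩
  rw [potential_eq hp, potential_eq hp]
  refine mul_lt_mul_of_pos_left ?_ hμ
  have h1 : p + 1 ≤ |x| ^ (p - 1) := by
    have := Real.rpow_le_rpow (by positivity) hC (by linarith : 0 ≤ p - 1)
    rwa [← Real.rpow_mul (by linarith), one_div, inv_mul_cancel₀ (by linarith),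
      Real.rpow_one] at this
  have h2 : |y| ^ (p - 1) ≤ |x| ^ (p - 1) :=
    Real.rpow_le_rpow (abs_nonneg y) hyx.le (by linarith)
  have h3 : y ^ 2 < x ^ 2 := sq_lt_sq.2 hyx
  have h4 : 1 ≤ |x| ^ (p - 1) / (p + 1) := by rwa [one_le_div (by linarith)]
  have h5 : |y| ^ (p - 1) / (p + 1) ≤ |x| ^ (p - 1) / (p + 1) := by gcongr
  have h6 := mul_le_mul_of_nonneg_left h5 (sq_nonneg y)
  nlinarith

/-- A superquadratic power dominates a multiple of the square. -/
theorem exists_sq_le_rpow (hp : 1 < p) {c₁ : ℝ} (hc₁ : 0 < c₁) (c₂ : ℝ) :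
    ∃ C : ℝ, 0 ≤ C ∧ ∀ x : ℝ, c₂ * x ^ 2 ≤ c₁ * |x| ^ (p + 1) + C := by
  obtain ⟨K, hK, hK0⟩ := (((tendsto_rpow_atTop (by linarith : 0 < p - 1)).eventually_ge_atTop
    (|c₂| / c₁)).and (eventually_ge_atTop (0 : ℝ))).exists
  refine ⟨|c₂| * K ^ 2, by positivity, fun x => ?_⟩
  have h0 : 0 ≤ |x| ^ (p + 1) := by positivity
  have h1 : c₂ * x ^ 2 ≤ |c₂| * x ^ 2 := mul_le_mul_of_nonneg_right (le_abs_self _) (sq_nonneg x)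
  rcases le_total |x| K with h | h
  · have h2 : x ^ 2 ≤ K ^ 2 := by rw [← sq_abs]; exact pow_le_pow_left₀ (abs_nonneg x) h 2
    nlinarith [mul_le_mul_of_nonneg_left h2 (abs_nonneg c₂), mul_nonneg hc₁.le h0]
  · have h2 : K ^ (p - 1) ≤ |x| ^ (p - 1) := Real.rpow_le_rpow hK0 h (by linarith)
    have h3 : |c₂| ≤ c₁ * |x| ^ (p - 1) := by
      rw [div_le_iff₀ hc₁] at hK
      nlinarith
    rw [abs_rpow_add_one hp]
    nlinarith [mul_le_mul_of_nonneg_right h3 (sq_nonneg x), mul_nonneg (abs_nonneg c₂) (sq_nonneg K)]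

theorem nonlin_nonpos (hp : 1 < p) (hμ : 0 < μ) {x : ℝ} (hx : |x| ≤ 1) (hx0 : 0 ≤ x) :
    nonlin p μ x ≤ 0 := by
  have h1 : |x| ^ (p - 1) ≤ 1 := Real.rpow_le_one (abs_nonneg x) hx (by linarith)
  have e' : nonlin p μ x = μ * ((|x| ^ (p - 1) - 1) * x) := by rw [nonlin]; ring
  rw [e']
  exact mul_nonpos_of_nonneg_of_nonpos hμ.le (mul_nonpos_of_nonpos_of_nonneg (by linarith) hx0)

/-- The nonlinearity frozen outside `[-M, M]`. -/
noncomputable def truncNonlin (p μ M x : ℝ) : ℝ := nonlin p μ (max (-M) (min x M))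

theorem truncNonlin_of_abs_le {M x : ℝ} (h : |x| ≤ M) : truncNonlin p μ M x = nonlin p μ x := by
  rw [abs_le] at h
  rw [truncNonlin, min_eq_left h.2, max_eq_right h.1]

theorem exists_lipschitz_truncNonlin (hp : 1 < p) (hμ : 0 < μ) {M : ℝ} (hM : 0 ≤ M) :
    ∃ K : ℝ, 0 < K ∧ ∀ x y : ℝ, |truncNonlin p μ M x - truncNonlin p μ M y| ≤ K * |x - y| := by
  obtain ⟨K, hK, h⟩ := exists_lipschitz_nonlin hp hμ M
  have hb : ∀ x : ℝ, |max (-M) (min x M)| ≤ M := fun x =>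
    abs_le.2 ⟨le_max_left _ _, max_le (by linarith) (min_le_right _ _)⟩
  refine ⟨K, hK, fun x y => (h _ _ (hb x) (hb y)).trans
    (mul_le_mul_of_nonneg_left ?_ hK.le)⟩
  calc |max (-M) (min x M) - max (-M) (min y M)| ≤ |min x M - min y M| := by
        simpa using abs_max_sub_max_le_max (-M) (min x M) (-M) (min y M)
    _ ≤ |x - y| := by simpa using abs_min_sub_min_le_max x M y M

end Nonlinearity

/-! ### The singular initial value problem in abstract form. -/

/-- `Q` is the weight of a singular radial problem on `[0, m]` with logarithmic derivative `q`,
behaving like `r ^ a` at the origin. -/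
structure IsWeight (Q q : ℝ → ℝ) (a : ℕ) (m : ℝ) : Prop where
  pos_length : 0 < m
  cont : Continuous Q
  zero : Q 0 = 0
  pos : ∀ r ∈ Ioc 0 m, 0 < Q r
  mono : MonotoneOn Q (Icc 0 m)
  deriv : ∀ r ∈ Ioo 0 m, HasDerivAt Q (q r * Q r) r
  contOn : ContinuousOn q (Ioc 0 m)
  nonneg : ∀ r ∈ Ioo 0 m, 0 ≤ q r
  tendsto : Tendsto (fun r => r * q r) (𝓝[>] 0) (𝓝 a)
  lower : ∃ c > 0, ∀ r ∈ Icc 0 m, c * r ^ a ≤ Q r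

/-- `w` solves `w'' + q w' + g(w) = 0` on `(0, T)` with `w(0) = α`, `w'(0) = 0`, and `v = w'`. -/
structure ShootSol (q : ℝ → ℝ) (T : ℝ) (g : ℝ → ℝ) (α : ℝ) (w v : ℝ → ℝ) : Prop where
  cont : Continuous w
  cont' : Continuous v
  init : w 0 = α
  init' : v 0 = 0
  deriv : ∀ r ∈ Ioo 0 T, HasDerivAt w (v r) r
  deriv' : ∀ r ∈ Ioo 0 T, HasDerivAt v (-(q r * v r) - g (w r)) r

/-- The energy `v² / 2 + potential (w)` of the equation. -/
noncomputable def energy (p μ : ℝ) (w v : ℝ → ℝ) (r : ℝ) : ℝ := v r ^ 2 / 2 + potential p μ (w r)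

end NodalYamabe

/-! ### Energy and flux estimates for solutions shot from the singular point. -/

namespace NodalYamabe

variable {Q q w v : ℝ → ℝ} {a : ℕ} {m p μ α : ℝ}

theorem ShootSol.hasDerivAt_energy {T : ℝ} (hp : 1 < p)
    (h : ShootSol q T (nonlin p μ) α w v) {r : ℝ} (hr : r ∈ Ioo 0 T) :
    HasDerivAt (energy p μ w v) (-(q r * v r ^ 2)) r := by
  have h1 := (((h.deriv' r hr).pow 2).div_const 2).add
    ((hasDerivAt_potential (μ := μ) hp (w r)).comp r (h.deriv r hr))
  refine h1.congr_deriv ?_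
  push_cast
  ring

theorem ShootSol.continuous_energy {T : ℝ} {g : ℝ → ℝ} (hp : 1 < p)
    (h : ShootSol q T g α w v) : Continuous (energy p μ w v) :=
  ((h.cont'.pow 2).div_const 2).add ((continuous_potential hp).comp h.cont)

/-- The first-order term is damping: the energy has derivative `-q v²` and `q ≥ 0`. The general
endpoint `T ≤ m` is needed for the first-exit argument in `ShootSol.of_trunc`. -/
theorem ShootSol.antitoneOn_energy {T : ℝ} (hp : 1 < p) (hQ : IsWeight Q q a m) (hT : T ≤ m)
    (h : ShootSol q T (nonlin p μ) α w v) : AntitoneOn (energy p μ w v) (Icc 0 T) := by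
  refine antitoneOn_of_deriv_nonpos (convex_Icc _ _) (h.continuous_energy hp).continuousOn ?_ ?_
  · intro r hr
    rw [interior_Icc] at hr
    exact (h.hasDerivAt_energy hp hr).differentiableAt.differentiableWithinAt
  · intro r hr
    rw [interior_Icc] at hr
    rw [(h.hasDerivAt_energy hp hr).deriv]
    have := hQ.nonneg r ⟨hr.1, hr.2.trans_le hT⟩
    nlinarith [mul_nonneg this (sq_nonneg (v r))]

theorem ShootSol.potential_le {T : ℝ} (hp : 1 < p) (hQ : IsWeight Q q a m) (hT : T ≤ m)
    (h : ShootSol q T (nonlin p μ) α w v) {r : ℝ} (hr : r ∈ Icc 0 T) :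
    potential p μ (w r) ≤ potential p μ α := by
  have h1 := h.antitoneOn_energy hp hQ hT (left_mem_Icc.2 (hr.1.trans hr.2)) hr hr.1
  have h2 : energy p μ w v 0 = potential p μ α := by simp [energy, h.init, h.init']
  rw [h2, energy] at h1
  nlinarith [sq_nonneg (v r)]

/-- The flux `Q v` satisfies `(Q v)' = -Q g(w)`. -/
theorem ShootSol.hasDerivAt_flux {T : ℝ} {g : ℝ → ℝ} (hQ : IsWeight Q q a m) (hT : T ≤ m)
    (h : ShootSol q T g α w v) {r : ℝ} (hr : r ∈ Ioo 0 T) :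
    HasDerivAt (fun s => Q s * v s) (-(Q r * g (w r))) r := by
  refine ((hQ.deriv r ⟨hr.1, hr.2.trans_le hT⟩).mul (h.deriv' r hr)).congr_deriv ?_
  ring

/-- The mean value theorem is applied to the flux `Q v`, which starts at zero, so the singular `q`
never appears. Monotonicity of `Q` then allows division by `Q r`. -/
theorem ShootSol.abs_deriv_le {T B : ℝ} {g : ℝ → ℝ} (hQ : IsWeight Q q a m) (hT : T ≤ m)
    (h : ShootSol q T g α w v) (hB : ∀ r ∈ Icc 0 T, |g (w r)| ≤ B) {r : ℝ} (hr : r ∈ Icc 0 T) :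
    |v r| ≤ B * r := by
  rcases hr.1.eq_or_lt with rfl | h0
  · simp [h.init']
  obtain ⟨c, hc, hc'⟩ := exists_hasDerivAt_eq_slope (fun s => Q s * v s)
    (fun s => -(Q s * g (w s))) h0 (hQ.cont.mul h.cont').continuousOn
    (fun s hs => h.hasDerivAt_flux hQ hT ⟨hs.1, hs.2.trans_le hr.2⟩)
  have hQr : 0 < Q r := hQ.pos r ⟨h0, hr.2.trans hT⟩
  have hQc : 0 < Q c := hQ.pos c ⟨hc.1, (hc.2.le.trans hr.2).trans hT⟩
  have hle : Q c ≤ Q r := hQ.mono ⟨hc.1.le, (hc.2.le.trans hr.2).trans hT⟩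
    ⟨hr.1, hr.2.trans hT⟩ hc.2.le
  have hgc := hB c ⟨hc.1.le, hc.2.le.trans hr.2⟩
  simp only [hQ.zero, zero_mul, sub_zero] at hc'
  have e : Q r * v r = -(Q c * g (w c)) * r := by field_simp at hc'; linarith
  have e2 : Q r * |v r| = Q c * |g (w c)| * r := by
    rw [← abs_of_pos hQr, ← abs_mul, e, abs_mul, abs_neg, abs_mul, abs_of_pos hQc, abs_of_pos h0]
  have h3 : Q c * |g (w c)| * r ≤ Q r * B * r := by
    have := mul_le_mul hle hgc (abs_nonneg _) hQr.le
    exact mul_le_mul_of_nonneg_right this h0.le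
  have : Q r * |v r| ≤ Q r * (B * r) := by linarith
  exact le_of_mul_le_mul_left this hQr

theorem ShootSol.abs_sub_init_le {T B : ℝ} {g : ℝ → ℝ} (hQ : IsWeight Q q a m) (hT : T ≤ m)
    (h : ShootSol q T g α w v) (hB : ∀ r ∈ Icc 0 T, |g (w r)| ≤ B) {r : ℝ} (hr : r ∈ Icc 0 T) :
    |w r - α| ≤ B * r ^ 2 := by
  rcases hr.1.eq_or_lt with rfl | h0
  · simp [h.init]
  obtain ⟨c, hc, hc'⟩ := exists_hasDerivAt_eq_slope w v h0 h.cont.continuousOn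
    (fun s hs => h.deriv s ⟨hs.1, hs.2.trans_le hr.2⟩)
  have h1 := h.abs_deriv_le hQ hT hB ⟨hc.1.le, hc.2.le.trans hr.2⟩
  rw [h.init, sub_zero, eq_div_iff h0.ne'] at hc'
  have hB0 : 0 ≤ B := (abs_nonneg _).trans (hB 0 ⟨le_rfl, hr.1.trans hr.2⟩)
  rw [← hc', abs_mul, abs_of_pos h0]
  have : B * c ≤ B * r := mul_le_mul_of_nonneg_left hc.2.le hB0
  nlinarith

theorem IsWeight.continuous_integral (hQ : IsWeight Q q a m) {f : ℝ → ℝ} (hf : Continuous f) :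
    Continuous fun r => ∫ s in (0 : ℝ)..r, Q s * f s :=
  intervalIntegral.continuous_primitive (fun _ _ => (hQ.cont.mul hf).intervalIntegrable _ _) 0

/-- By l'Hôpital's rule the quotient of derivatives is `f r / (1 + r q)`, and `r q → a`. -/
theorem IsWeight.tendsto_average (hQ : IsWeight Q q a m) {f : ℝ → ℝ} (hf : Continuous f) :
    Tendsto (fun r => (∫ s in (0 : ℝ)..r, Q s * f s) / (r * Q r)) (𝓝[>] 0)
      (𝓝 (f 0 / (a + 1))) := by
  refine HasDerivAt.lhopital_zero_right_on_Ioo (f' := fun r => Q r * f r)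
    (g' := fun r => Q r + r * (q r * Q r)) hQ.pos_length ?_ ?_ ?_ ?_ ?_ ?_
  · exact fun r _ => ((hQ.cont.mul hf).integral_hasStrictDerivAt 0 r).hasDerivAt
  · intro r hr
    refine ((hasDerivAt_id r).mul (hQ.deriv r hr)).congr_deriv ?_
    simp
  · intro r hr
    have h1 := hQ.pos r ⟨hr.1, hr.2.le⟩
    have h2 := hQ.nonneg r hr
    have := hr.1
    positivity
  · have := (hQ.continuous_integral hf).tendsto 0
    simp only [intervalIntegral.integral_same] at this
    exact this.mono_left nhdsWithin_le_nhds
  · have : Tendsto (fun r => r * Q r) (𝓝 0) (𝓝 (0 * Q 0)) := (continuous_id.mul hQ.cont).tendsto 0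
    rw [zero_mul] at this
    exact this.mono_left nhdsWithin_le_nhds
  · have h1 : Tendsto (fun r => f r / (1 + r * q r)) (𝓝[>] 0) (𝓝 (f 0 / (1 + a))) :=
      ((hf.tendsto 0).mono_left nhdsWithin_le_nhds).div (tendsto_const_nhds.add hQ.tendsto)
        (by positivity)
    rw [add_comm (a : ℝ)]
    refine h1.congr' ?_
    filter_upwards [Ioo_mem_nhdsGT hQ.pos_length] with r hr
    have h1 := (hQ.pos r ⟨hr.1, hr.2.le⟩).ne'
    rw [show Q r + r * (q r * Q r) = Q r * (1 + r * q r) by ring, mul_div_mul_left _ _ h1]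

/-! ### The Pohozaev functional and growth of the energy. -/

/-- Near the origin the Pohozaev multiplier has a favourable sign below the critical exponent. -/
theorem IsWeight.exists_pohozaev_multiplier (hQ : IsWeight Q q a m) (ha : 1 ≤ a)
    (hpa : ((a : ℝ) - 1) * p < a + 3) :
    ∃ e, p + 1 < e ∧ ∃ T ∈ Ioo 0 m, ∀ r ∈ Ioo 0 T,
      e * q r * (∫ s in (0 : ℝ)..r, Q s) ≤ (e / 2 + 1) * Q r := by
  have ha' : (1 : ℝ) ≤ a := by exact_mod_cast ha
  obtain ⟨e, he, he'⟩ : ∃ e, p + 1 < e ∧ e * a / (a + 1) < e / 2 + 1 := by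
    -- The second condition amounts to `e (a - 1) < 2 (a + 1)`. Subcriticality says exactly that `e
    -- = p + 1` satisfies it with slack `2 (a + 1) - (p + 1) (a - 1) > 0`. Raising `e` by the slack
    -- divided by `2a` keeps it true.
    refine ⟨p + 1 + (2 * (a + 1) - (p + 1) * (a - 1)) / (2 * a), ?_, ?_⟩
    · have : 0 < (2 * (a + 1) - (p + 1) * (a - 1)) / (2 * (a : ℝ)) := by
        apply div_pos <;> nlinarith
      linarith
    · rw [div_lt_iff₀ (by positivity)]
      set d := (2 * (a + 1) - (p + 1) * (a - 1)) / (2 * (a : ℝ)) with hd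
      have h1 : d * (2 * a) = 2 * (a + 1) - (p + 1) * (a - 1) := by
        rw [hd]; field_simp
      have h2 : 0 < d := by
        rw [hd]; apply div_pos <;> nlinarith
      nlinarith
  refine ⟨e, he, ?_⟩
  have h1 := (hQ.tendsto_average (f := fun _ => 1) continuous_const).mul hQ.tendsto
  have h2 : ∀ᶠ r in 𝓝[>] (0 : ℝ), e * ((∫ s in (0 : ℝ)..r, Q s * 1) / (r * Q r) * (r * q r))
      < e / 2 + 1 := by
    have h3 := h1.const_mul e
    refine h3.eventually_lt_const ?_
    refine lt_of_eq_of_lt ?_ he'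
    field_simp
  have h4 := h2.and (Ioo_mem_nhdsGT hQ.pos_length)
  rw [eventually_nhdsWithin_iff] at h4
  obtain ⟨ε, hε, h5⟩ := Metric.eventually_nhds_iff.1 h4
  refine ⟨min (ε / 2) (m / 2), ⟨lt_min (by linarith) (by linarith [hQ.pos_length]),
    (min_le_right _ _).trans_lt (by linarith [hQ.pos_length])⟩, fun r hr => ?_⟩
  obtain ⟨h6, h7⟩ := h5 (y := r) (by
    rw [Real.dist_eq, sub_zero, abs_of_pos hr.1]
    linarith [hr.2.trans_le (min_le_left (ε / 2) (m / 2))]) hr.1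
  have h8 := hQ.pos r ⟨h7.1, h7.2.le⟩
  have h9 := hr.1.ne'
  simp only [mul_one] at h6
  have : e * ((∫ s in (0 : ℝ)..r, Q s) / (r * Q r) * (r * q r)) * Q r
    = e * q r * (∫ s in (0 : ℝ)..r, Q s) := by field_simp
  rw [← this]
  exact mul_le_mul_of_nonneg_right h6.le h8.le

theorem IsWeight.hasDerivAt_integral (hQ : IsWeight Q q a m) (r : ℝ) :
    HasDerivAt (fun r => ∫ s in (0 : ℝ)..r, Q s) (Q r) r :=
  (hQ.cont.integral_hasStrictDerivAt 0 r).hasDerivAt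

theorem IsWeight.exists_pow_le_integral (hQ : IsWeight Q q a m) :
    ∃ c > 0, ∀ r ∈ Icc 0 m, c * r ^ (a + 1) ≤ ∫ s in (0 : ℝ)..r, Q s := by
  obtain ⟨c, hc, h⟩ := hQ.lower
  refine ⟨c / (a + 1), by positivity, fun r hr => ?_⟩
  have h1 : ∫ s in (0 : ℝ)..r, c * s ^ a = c / (a + 1) * r ^ (a + 1) := by
    rw [intervalIntegral.integral_const_mul, integral_pow]
    simp
    ring
  rw [← h1]
  refine intervalIntegral.integral_mono_on hr.1
    (by fun_prop : Continuous fun s => c * s ^ a).continuousOn.intervalIntegrable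
    (hQ.cont.intervalIntegrable _ _) fun s hs => h s ⟨hs.1, hs.2.trans hr.2⟩

/-- The derivative of the Pohozaev functional `e (∫ Q) E + Q w v` is bounded below. -/
theorem ShootSol.pohozaev_deriv (hp : 1 < p) (hQ : IsWeight Q q a m)
    (h : ShootSol q m (nonlin p μ) α w v) (e : ℝ) {r : ℝ} (hr : r ∈ Ioo 0 m) :
    HasDerivAt (fun r => e * (∫ s in (0 : ℝ)..r, Q s) * energy p μ w v r + w r * (Q r * v r))
      (Q r * (e * potential p μ (w r) - w r * nonlin p μ (w r)) +
        ((e / 2 + 1) * Q r - e * q r * (∫ s in (0 : ℝ)..r, Q s)) * v r ^ 2) r := by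
  refine ((((hQ.hasDerivAt_integral r).const_mul e).mul (h.hasDerivAt_energy hp hr)).add
    ((h.deriv r hr).mul (h.hasDerivAt_flux hQ le_rfl hr))).congr_deriv ?_
  rw [energy]
  ring

/-- For `e > p + 1` the coefficient of the superquadratic power is positive, so the integrand is
bounded below and large where `w` is large. -/
theorem pohozaev_integrand_eq (hp : 1 < p) (e x : ℝ) :
    e * potential p μ x - x * nonlin p μ x
      = μ * ((e / (p + 1) - 1) * |x| ^ (p + 1) - (e / 2 - 1) * x ^ 2) := by
  rw [potential, nonlin, abs_rpow_add_one hp]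
  ring

/-- Quadratic terms are controlled by the energy. -/
theorem exists_sq_le_energy (hp : 1 < p) (hμ : 0 < μ) :
    ∃ C : ℝ, ∀ (w v : ℝ → ℝ) (r : ℝ), (w r ^ 2 + v r ^ 2) / 2 ≤ energy p μ w v r + C := by
  obtain ⟨C, -, h⟩ := exists_sq_le_rpow hp (c₁ := μ / (p + 1)) (by positivity) (1 / 2 + μ / 2)
  refine ⟨C, fun w v r => ?_⟩
  have := h (w r)
  have e : μ / (p + 1) * |w r| ^ (p + 1) = μ * (|w r| ^ (p + 1) / (p + 1)) := by ring
  rw [energy, potential]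
  linarith

/-- Below the critical exponent the energy at a fixed point near the origin
tends to infinity with the initial value. -/
theorem IsWeight.exists_energy_large (hQ : IsWeight Q q a m) (ha : 1 ≤ a) (hp : 1 < p)
    (hμ : 0 < μ) (hpa : ((a : ℝ) - 1) * p < a + 3) :
    ∃ T ∈ Ioo 0 m, ∀ E₀ : ℝ, ∀ᶠ α in atTop, ∀ w v : ℝ → ℝ,
      ShootSol q m (nonlin p μ) α w v → E₀ ≤ energy p μ w v T := by
  obtain ⟨e, he, T, hT, hmul⟩ := hQ.exists_pohozaev_multiplier ha hpa
  obtain ⟨c, hc, hJ⟩ := hQ.exists_pow_le_integral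
  obtain ⟨C₀, hC₀, hpot⟩ := exists_potential_lt hp hμ
  set η := e / (p + 1) - 1 with hη
  have hη0 : 0 < η := by
    rw [hη, sub_pos, one_lt_div (by linarith)]; exact he
  obtain ⟨C₁, hC₁, hyoung⟩ := exists_sq_le_rpow hp (half_pos hη0) (e / 2 - 1)
  obtain ⟨C₂, hC₂⟩ := exists_sq_le_energy hp hμ
  refine ⟨T, hT, fun E₀ => ?_⟩
  set J : ℝ → ℝ := fun r => ∫ s in (0 : ℝ)..r, Q s with hJdef
  have hJ0 : J 0 = 0 := by simp [hJdef]
  have hJc : Continuous J := continuous_iff_continuousAt.2 fun r =>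
    (hQ.hasDerivAt_integral r).continuousAt
  -- Chosen so that the drift bound `μ α ^ p r²` is at most `α / 2` for `r ≤ R α`; up to there `w`
  -- stays above `α / 2`.
  set R : ℝ → ℝ := fun α => √(1 / (2 * μ * α ^ (p - 1))) with hR
  -- The power `(α / 2) ^ (p + 1)` is weighted by `∫ Q` up to `R α`, which is at least a multiple of
  -- `R α ^ (a + 1)`. The resulting exponent is `σ`, and `σ > 0` is equivalent to subcriticality.
  set σ := p + 1 - (p - 1) * (a + 1) / 2 with hσ
  have hσ0 : 0 < σ := by rw [hσ]; nlinarith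
  -- the lower bound grows like a positive power of the initial value
  have hgrow : Tendsto (fun α : ℝ => μ * (η / 2) * (α / 2) ^ (p + 1) * (c * R α ^ (a + 1)))
      atTop atTop := by
    have h1 : Tendsto (fun α : ℝ => μ * (η / 2) * (1 / 2) ^ (p + 1) * c *
        (1 / (2 * μ)) ^ (((a : ℝ) + 1) / 2) * α ^ σ) atTop atTop :=
      (tendsto_rpow_atTop hσ0).const_mul_atTop (by positivity)
    refine h1.congr' ?_
    filter_upwards [eventually_gt_atTop 0] with α hα
    have e1 : R α ^ (a + 1) = (1 / (2 * μ)) ^ (((a : ℝ) + 1) / 2)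
        * α ^ (-((p - 1) * (a + 1) / 2)) := by
      rw [hR]
      simp only
      rw [Real.sqrt_eq_rpow, ← Real.rpow_mul_natCast (by positivity),
        show 1 / (2 * μ * α ^ (p - 1)) = 1 / (2 * μ) * α ^ (-(p - 1)) by
          rw [Real.rpow_neg hα.le]; field_simp,
        Real.mul_rpow (by positivity) (by positivity), ← Real.rpow_mul hα.le]
      congr 2 <;> (push_cast; ring)
    rw [e1, hσ, sub_eq_add_neg, Real.rpow_add hα, show α / 2 = 1 / 2 * α by ring,
      Real.mul_rpow (by norm_num) hα.le]
    ring
  have hRsmall : ∀ᶠ α in atTop, R α < T := by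
    have h1 : Tendsto R atTop (𝓝 0) := by
      have h2 : Tendsto (fun α : ℝ => 1 / (2 * μ * α ^ (p - 1))) atTop (𝓝 0) := by
        refine Tendsto.const_div_atTop ?_ 1
        exact (tendsto_rpow_atTop (by linarith)).const_mul_atTop (by positivity)
      have := (Real.continuous_sqrt.tendsto 0).comp h2
      rwa [Real.sqrt_zero] at this
    exact h1.eventually_lt_const hT.1
  filter_upwards [hRsmall, eventually_ge_atTop C₀,
    hgrow.eventually_gt_atTop ((e * J T + Q T) * E₀ + Q T * C₂ + μ * C₁ * J T)]
    with α hRT hαC hbig w v h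
  have hα1 : 1 ≤ α := hC₀.trans hαC
  have hRpos : 0 < R α := Real.sqrt_pos.2 (by positivity)
  have hwle : ∀ r ∈ Icc 0 m, |w r| ≤ α := by
    intro r hr
    by_contra! hlt
    have h1 := hpot (w r) α (by rwa [abs_of_pos (by linarith)]) (hαC.trans hlt.le)
    exact absurd (h.potential_le hp hQ le_rfl hr) (not_le.2 h1)
  have hwge : ∀ r ∈ Icc 0 (R α), α / 2 ≤ w r := by
    intro r hr
    have hrm : r ∈ Icc 0 m := ⟨hr.1, hr.2.trans (hRT.le.trans hT.2.le)⟩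
    have h1 := h.abs_sub_init_le hQ le_rfl (B := μ * α ^ p)
      (fun s hs => abs_nonlin_le hp hμ hα1 (hwle s hs)) hrm
    have h2 : r ^ 2 ≤ 1 / (2 * μ * α ^ (p - 1)) := by
      calc r ^ 2 ≤ R α ^ 2 := pow_le_pow_left₀ hr.1 hr.2 2
        _ = _ := Real.sq_sqrt (by positivity)
    have e3 : α ^ p = α ^ (p - 1) * α := by
      rw [← Real.rpow_add_one (by linarith)]; ring_nf
    have h3 : μ * α ^ p * r ^ 2 ≤ α / 2 := by
      calc μ * α ^ p * r ^ 2 ≤ μ * α ^ p * (1 / (2 * μ * α ^ (p - 1))) :=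
            mul_le_mul_of_nonneg_left h2 (by positivity)
        _ = α / 2 := by
            rw [e3]
            have : α ^ (p - 1) ≠ 0 := by positivity
            field_simp
    linarith [(abs_le.1 (h1.trans h3)).1]
  set P : ℝ → ℝ := fun r => e * J r * energy p μ w v r + w r * (Q r * v r) with hP
  have hPc : Continuous P := ((continuous_const.mul hJc).mul (h.continuous_energy hp)).add
    (h.cont.mul (hQ.cont.mul h.cont'))
  have hP0 : P 0 = 0 := by simp [hP, hJ0, h.init']
  have hPd : ∀ r ∈ Ioo 0 T, ∃ d, HasDerivAt P d r ∧
      Q r * (μ * (η / 2 * |w r| ^ (p + 1) - C₁)) ≤ d := by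
    intro r hr
    have hrm : r ∈ Ioo 0 m := ⟨hr.1, hr.2.trans hT.2⟩
    refine ⟨_, h.pohozaev_deriv hp hQ e hrm, ?_⟩
    have h1 := mul_nonneg (sub_nonneg.2 (hmul r hr)) (sq_nonneg (v r))
    have h2 : μ * (η / 2 * |w r| ^ (p + 1) - C₁)
        ≤ e * potential p μ (w r) - w r * nonlin p μ (w r) := by
      rw [pohozaev_integrand_eq hp]
      refine mul_le_mul_of_nonneg_left ?_ hμ.le
      have := hyoung (w r)
      linarith
    have h3 := mul_le_mul_of_nonneg_left h2 (hQ.pos r ⟨hrm.1, hrm.2.le⟩).le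
    linarith
  -- A lower bound `k` for the superquadratic part gives `P' ≥ (k - μ C₁) J'`. It is used with large
  -- `k` before `R α` and with `k = 0` after it, where only the gain already made must survive.
  have hmono : ∀ {A B k : ℝ}, 0 ≤ A → A ≤ B → B ≤ T →
      (∀ r ∈ Ioo A B, k ≤ μ * (η / 2) * |w r| ^ (p + 1)) →
      P A + (μ * C₁ - k) * J A ≤ P B + (μ * C₁ - k) * J B := by
    intro A B k hA hAB hBT hk
    have : MonotoneOn (fun r => P r + (μ * C₁ - k) * J r) (Icc A B) := by
      have hd : ∀ r ∈ Ioo A B, ∃ d, HasDerivAt (fun r => P r + (μ * C₁ - k) * J r) d r ∧ 0 ≤ d := by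
        intro r hr
        have hr' : r ∈ Ioo 0 T := ⟨hA.trans_lt hr.1, hr.2.trans_le hBT⟩
        obtain ⟨d, hd, hd'⟩ := hPd r hr'
        refine ⟨_, hd.add ((hQ.hasDerivAt_integral r).const_mul _), ?_⟩
        have h1 := hQ.pos r ⟨hr'.1, (hr'.2.trans hT.2).le⟩
        have h2 := mul_nonneg h1.le (sub_nonneg.2 (hk r hr))
        linarith
      refine monotoneOn_of_deriv_nonneg (convex_Icc _ _)
        (hPc.add (continuous_const.mul hJc)).continuousOn ?_ ?_
      · intro r hr
        rw [interior_Icc] at hr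
        obtain ⟨d, hd, -⟩ := hd r hr
        exact hd.differentiableAt.differentiableWithinAt
      · intro r hr
        rw [interior_Icc] at hr
        obtain ⟨d, hd, hd'⟩ := hd r hr
        rwa [hd.deriv]
    exact this (left_mem_Icc.2 hAB) (right_mem_Icc.2 hAB) hAB
  have h1 := hmono (A := 0) (B := R α) (k := μ * (η / 2) * (α / 2) ^ (p + 1)) le_rfl hRpos.le
    hRT.le (by
      intro r hr
      have h2 := hwge r ⟨hr.1.le, hr.2.le⟩
      refine mul_le_mul_of_nonneg_left ?_ (by positivity)
      exact Real.rpow_le_rpow (by linarith) (h2.trans (le_abs_self _)) (by linarith))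
  have h2 := hmono (A := R α) (B := T) (k := 0) hRpos.le hRT.le le_rfl
    (fun r _ => by positivity)
  rw [hP0, hJ0] at h1
  have h3 : μ * (η / 2) * (α / 2) ^ (p + 1) * (c * R α ^ (a + 1))
      ≤ μ * (η / 2) * (α / 2) ^ (p + 1) * J (R α) :=
    mul_le_mul_of_nonneg_left (hJ _ ⟨hRpos.le, hRT.le.trans hT.2.le⟩) (by positivity)
  have hQT : 0 < Q T := hQ.pos T ⟨hT.1, hT.2.le⟩
  have hJT : 0 ≤ J T := le_trans (by have := hT.1; positivity) (hJ T ⟨hT.1.le, hT.2.le⟩)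
  have hep : 0 < e := by linarith
  -- The boundary term `Q w v` is absorbed into the energy, so a large Pohozaev functional forces a
  -- large energy.
  have h4 : P T ≤ (e * J T + Q T) * energy p μ w v T + Q T * C₂ := by
    have h5 := mul_le_mul_of_nonneg_left (hC₂ w v T) hQT.le
    have h6 : w T * (Q T * v T) ≤ Q T * ((w T ^ 2 + v T ^ 2) / 2) := by
      nlinarith [mul_nonneg hQT.le (sq_nonneg (w T - v T))]
    simp only [hP]
    nlinarith
  by_contra! hlt
  have h7 : (e * J T + Q T) * energy p μ w v T ≤ (e * J T + Q T) * E₀ :=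
    mul_le_mul_of_nonneg_left hlt.le (by positivity)
  linarith

/-! ### From large energy to zeros. -/

/-- A solution of large energy on an interval vanishes somewhere on it. -/
theorem IsWeight.exists_zero_of_energy_large (hQ : IsWeight Q q a m) (hp : 1 < p) (hμ : 0 < μ)
    {S T : ℝ} (hS : 0 < S) (hST : S < T) (hT : T ≤ m) :
    ∃ E₀ : ℝ, ∀ (α : ℝ) (w v : ℝ → ℝ), ShootSol q m (nonlin p μ) α w v →
      (∀ r ∈ Icc S T, E₀ ≤ energy p μ w v r) → ∃ r ∈ Icc S T, w r = 0 := by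
  obtain ⟨q₀, hq₀⟩ := (isCompact_Icc (a := S) (b := T)).exists_bound_of_continuousOn
    (hQ.contOn.mono fun r hr => ⟨hS.trans_le hr.1, hr.2.trans hT⟩)
  have hq₀0 : 0 ≤ q₀ := (norm_nonneg _).trans (hq₀ S (left_mem_Icc.2 hST.le))
  -- At the rate `-κ / 4`, an arctangent would drop by the full width `π` of its open range over
  -- `[S, T]`.
  set κ := 4 * Real.pi / (T - S) with hκ
  have hTS : 0 < T - S := sub_pos.2 hST
  have hκ0 : 0 < κ := by have := Real.pi_pos; positivity
  set C := κ ^ 2 / 4 + q₀ ^ 2 + μ with hC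
  obtain ⟨K, hK, hK1⟩ := (((tendsto_rpow_atTop (by linarith : 0 < p - 1)).eventually_ge_atTop
    (C / μ)).and (eventually_ge_atTop (1 : ℝ))).exists
  rw [div_le_iff₀ hμ] at hK
  -- If `|w| ≥ K`, the term `μ |w| ^ (p - 1)` alone reaches `C`. Otherwise the potential is at most
  -- `μ K ^ (p + 1)`, so `v² / 2 ≥ C K² ≥ C w²`. Both cases give `hX`.
  refine ⟨C * K ^ 2 + μ * K ^ (p + 1), fun α w v h hE => ?_⟩
  by_contra! hne
  have hmem : ∀ r ∈ Ioo S T, r ∈ Ioo 0 m := fun r hr => ⟨hS.trans hr.1, hr.2.trans_le hT⟩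
  -- Without zeros, `u = v / w` satisfies the Riccati equation `u' = μ - μ |w| ^ (p - 1) - q u -
  -- u²`. The arctangent keeps the quantity bounded while `u` may be large.
  have hder : ∀ r ∈ Ioo S T, HasDerivAt (fun r => Real.arctan (v r / w r / κ))
      (1 / (1 + (v r / w r / κ) ^ 2) *
        ((μ - μ * |w r| ^ (p - 1) - q r * (v r / w r) - (v r / w r) ^ 2) / κ)) r := by
    intro r hr
    have hw := hne r ⟨hr.1.le, hr.2.le⟩
    refine (((h.deriv' r (hmem r hr)).div (h.deriv r (hmem r hr)) hw).div_const κ).arctan.congr_deriv ?_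
    congr 2
    rw [nonlin]
    field_simp
    ring
  have hcont : ContinuousOn (fun r => Real.arctan (v r / w r / κ)) (Icc S T) :=
    Real.continuous_arctan.comp_continuousOn
      ((h.cont'.continuousOn.div h.cont.continuousOn hne).div_const κ)
  obtain ⟨r, hr, hr'⟩ := exists_hasDerivAt_eq_slope _ _ hST hcont hder
  have hrI : r ∈ Icc S T := ⟨hr.1.le, hr.2.le⟩
  set u := v r / w r with hu
  have hw := hne r hrI
  have hX : C ≤ u ^ 2 / 2 + μ * |w r| ^ (p - 1) := by
    rcases le_total K |w r| with hle | hle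
    · have : K ^ (p - 1) ≤ |w r| ^ (p - 1) :=
        Real.rpow_le_rpow (by linarith) hle (by linarith)
      nlinarith [sq_nonneg u]
    · have h1 := hE r hrI
      have h2 : |w r| ^ (p + 1) ≤ K ^ (p + 1) := Real.rpow_le_rpow (abs_nonneg _) hle (by linarith)
      have h3 : potential p μ (w r) ≤ μ * K ^ (p + 1) := by
        rw [potential]
        refine mul_le_mul_of_nonneg_left ?_ hμ.le
        have h4 : |w r| ^ (p + 1) / (p + 1) ≤ |w r| ^ (p + 1) :=
          div_le_self (by positivity) (by linarith)
        nlinarith [sq_nonneg (w r)]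
      have h5 : C * K ^ 2 ≤ v r ^ 2 / 2 := by rw [energy] at h1; linarith
      have h6 : w r ^ 2 ≤ K ^ 2 := by rw [← sq_abs]; exact pow_le_pow_left₀ (abs_nonneg _) hle 2
      have h7 : C * w r ^ 2 ≤ v r ^ 2 / 2 :=
        (mul_le_mul_of_nonneg_left h6 (by positivity)).trans h5
      have h8 : u ^ 2 * w r ^ 2 = v r ^ 2 := by rw [hu]; field_simp
      have h9 : C ≤ u ^ 2 / 2 := by
        have hw2 : 0 < w r ^ 2 := by positivity
        refine le_of_mul_le_mul_right ?_ hw2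
        nlinarith
      have : 0 ≤ μ * |w r| ^ (p - 1) := by positivity
      linarith
  have hqr : |q r| ≤ q₀ := hq₀ r hrI
  have hqu : -(q r * u) ≤ u ^ 2 / 4 + q₀ ^ 2 := by
    have h1 : -(q r * u) ≤ |q r| * |u| := by rw [← abs_mul]; exact neg_le_abs _
    have h2 : |q r| * |u| ≤ q₀ * |u| := mul_le_mul_of_nonneg_right hqr (abs_nonneg u)
    nlinarith [sq_nonneg (|u| / 2 - q₀), sq_abs u]
  have hu' : μ - μ * |w r| ^ (p - 1) - q r * u - u ^ 2 ≤ -(κ ^ 2 + u ^ 2) / 4 := by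
    rw [hC] at hX
    linarith
  have hle : 1 / (1 + (u / κ) ^ 2) *
      ((μ - μ * |w r| ^ (p - 1) - q r * u - u ^ 2) / κ) ≤ -κ / 4 := by
    calc _ ≤ 1 / (1 + (u / κ) ^ 2) * (-(κ ^ 2 + u ^ 2) / 4 / κ) := by gcongr
      _ = -κ / 4 := by field_simp
  rw [hr', div_le_iff₀ hTS] at hle
  have e1 : -κ / 4 * (T - S) = -Real.pi := by rw [hκ]; field_simp
  rw [e1] at hle
  have := Real.neg_pi_div_two_lt_arctan (v T / w T / κ)
  have := Real.arctan_lt_pi_div_two (v S / w S / κ)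
  linarith

/-- Since the energy decreases in `r`, its largeness at the single point `T₀` is inherited by all of
`[S, T]`. -/
theorem IsWeight.exists_zero_of_large (hQ : IsWeight Q q a m) (ha : 1 ≤ a) (hp : 1 < p)
    (hμ : 0 < μ) (hpa : ((a : ℝ) - 1) * p < a + 3) :
    ∃ T₀ ∈ Ioo 0 m, ∀ S T : ℝ, 0 < S → S < T → T ≤ T₀ → ∀ᶠ α in atTop, ∀ w v : ℝ → ℝ,
      ShootSol q m (nonlin p μ) α w v → ∃ r ∈ Icc S T, w r = 0 := by
  obtain ⟨T₀, hT₀, hE⟩ := hQ.exists_energy_large ha hp hμ hpa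
  refine ⟨T₀, hT₀, fun S T hS hST hT => ?_⟩
  obtain ⟨E₀, hz⟩ := hQ.exists_zero_of_energy_large hp hμ hS hST (hT.trans hT₀.2.le)
  filter_upwards [hE E₀] with α hα w v h
  refine hz α w v h fun r hr => (hα w v h).trans ?_
  exact h.antitoneOn_energy hp hQ le_rfl ⟨hS.le.trans hr.1, (hr.2.trans hT).trans hT₀.2.le⟩
    ⟨hT₀.1.le, hT₀.2.le⟩ (hr.2.trans hT)

end NodalYamabe

/-! ### Existence and continuous dependence for the singular problem. -/

namespace NodalYamabe

variable {Q q w v : ℝ → ℝ} {a : ℕ} {m p μ α : ℝ}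

/-- The average `(∫₀ʳ Q f) / Q(r)`, a right inverse of `v ↦ v' + q v`. -/
noncomputable def weightedAverage (Q f : ℝ → ℝ) (r : ℝ) : ℝ := (∫ s in (0 : ℝ)..r, Q s * f s) / Q r

theorem weightedAverage_zero (Q f : ℝ → ℝ) : weightedAverage Q f 0 = 0 := by
  simp [weightedAverage]

theorem weightedAverage_sub (hQ : IsWeight Q q a m) {f g : ℝ → ℝ} (hf : Continuous f)
    (hg : Continuous g) (r : ℝ) :
    weightedAverage Q f r - weightedAverage Q g r = weightedAverage Q (fun s => f s - g s) r := by
  have := intervalIntegral.integral_sub ((hQ.cont.mul hf).intervalIntegrable (μ := MeasureTheory.volume) 0 r)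
    ((hQ.cont.mul hg).intervalIntegrable 0 r)
  simp only [Pi.mul_apply, ← mul_sub] at this
  rw [weightedAverage, weightedAverage, weightedAverage, ← sub_div, this]

theorem IsWeight.abs_weightedAverage_le (hQ : IsWeight Q q a m) {f b : ℝ → ℝ}
    (hb : Continuous b) {r : ℝ} (hr : r ∈ Icc 0 m)
    (h : ∀ s ∈ Icc 0 r, |f s| ≤ b s) : |weightedAverage Q f r| ≤ ∫ s in (0 : ℝ)..r, b s := by
  rcases hr.1.eq_or_lt with rfl | h0
  · simp [weightedAverage]
  have hQr := hQ.pos r ⟨h0, hr.2⟩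
  rw [weightedAverage, abs_div, abs_of_pos hQr, div_le_iff₀ hQr,
    mul_comm, ← intervalIntegral.integral_const_mul, ← Real.norm_eq_abs]
  refine intervalIntegral.norm_integral_le_of_norm_le h0.le (Eventually.of_forall ?_)
    ((continuous_const.mul hb).intervalIntegrable _ _)
  intro s hs
  have hs' : s ∈ Icc 0 r := ⟨hs.1.le, hs.2⟩
  have h1 : Q s ≤ Q r := hQ.mono ⟨hs'.1, hs'.2.trans hr.2⟩ hr hs'.2
  have h2 : 0 < Q s := hQ.pos s ⟨hs.1, hs'.2.trans hr.2⟩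
  rw [Real.norm_eq_abs, abs_mul, abs_of_pos h2]
  exact mul_le_mul h1 (h s hs') (abs_nonneg _) hQr.le

theorem IsWeight.continuousOn_weightedAverage (hQ : IsWeight Q q a m) {f : ℝ → ℝ}
    (hf : Continuous f) : ContinuousOn (weightedAverage Q f) (Icc 0 m) := by
  intro r hr
  rcases hr.1.eq_or_lt with rfl | h0
  · obtain ⟨B, hB⟩ := (isCompact_Icc (a := 0) (b := m)).exists_bound_of_continuousOn hf.continuousOn
    rw [ContinuousWithinAt, weightedAverage_zero]
    refine squeeze_zero_norm' (a := fun r => B * r) ?_ ?_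
    · filter_upwards [self_mem_nhdsWithin] with r hr
      have := hQ.abs_weightedAverage_le (f := f) (b := fun _ => B) continuous_const hr
        (fun s hs => hB s ⟨hs.1, hs.2.trans hr.2⟩)
      rw [Real.norm_eq_abs]
      refine this.trans (le_of_eq ?_)
      simp [mul_comm]
    · have : Tendsto (fun r => B * r) (𝓝 0) (𝓝 (B * 0)) := (continuous_const.mul continuous_id).tendsto 0
      rw [mul_zero] at this
      exact this.mono_left nhdsWithin_le_nhds
  · exact ((hQ.continuous_integral hf).continuousAt.div hQ.cont.continuousAt
      (hQ.pos r ⟨h0, hr.2⟩).ne').continuousWithinAt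

theorem IsWeight.hasDerivAt_weightedAverage (hQ : IsWeight Q q a m) {f : ℝ → ℝ}
    (hf : Continuous f) {r : ℝ} (hr : r ∈ Ioo 0 m) :
    HasDerivAt (weightedAverage Q f) (f r - q r * weightedAverage Q f r) r := by
  have hQr := (hQ.pos r ⟨hr.1, hr.2.le⟩).ne'
  refine (((hQ.cont.mul hf).integral_hasStrictDerivAt 0 r).hasDerivAt.div (hQ.deriv r hr)
    hQr).congr_deriv ?_
  simp only [weightedAverage, Pi.mul_apply]
  field_simp

/-- The singular initial value problem with a globally Lipschitz nonlinearity has a solution for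
every initial value, depending Lipschitz continuously on it. -/
theorem IsWeight.exists_family (hQ : IsWeight Q q a m) {g : ℝ → ℝ} {K : ℝ} (hK : 0 < K)
    (hg : ∀ x y, |g x - g y| ≤ K * |x - y|) (hg0 : g 0 = 0) :
    ∃ W V : ℝ → ℝ → ℝ, (∀ α, ShootSol q m g α (W α) (V α)) ∧
      (∀ r ∈ Icc 0 m, W 0 r = 0 ∧ V 0 r = 0) ∧
      ∃ C, 0 < C ∧ ∀ α β, ∀ r ∈ Icc 0 m,
        |W α r - W β r| ≤ C * |α - β| ∧ |V α r - V β r| ≤ C * |α - β| := by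
  have hm := hQ.pos_length
  have hgc : Continuous g := by
    have : LipschitzWith ⟨K, hK.le⟩ g := LipschitzWith.of_dist_le_mul fun x y => hg x y
    exact this.continuous
  -- Exponent of a Bielecki-type weighted norm: the integral operator has contraction constant `K /
  -- κ² ≤ 1 / 2`, however long the interval.
  set κ := 2 * K + 1 with hκ
  have hκ0 : 0 < κ := by linarith
  -- undo the exponential weight, and extend beyond `[0, m]`
  set E : C(Icc 0 m, ℝ) → ℝ → ℝ := fun u t => Real.exp (κ * t) * IccExtend hm.le u t with hE
  have hEc : ∀ u, Continuous (E u) := fun u =>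
    (by fun_prop : Continuous fun t => Real.exp (κ * t)).mul u.continuous.Icc_extend'
  have hEsub : ∀ u u' t, |E u t - E u' t| ≤ Real.exp (κ * t) * dist u u' := by
    intro u u' t
    rw [hE]
    simp only
    rw [← mul_sub, abs_mul, abs_of_pos (Real.exp_pos _)]
    exact mul_le_mul_of_nonneg_left (ContinuousMap.dist_apply_le_dist (f := u) (g := u') (projIcc 0 m hm.le t))
      (Real.exp_pos _).le
  set N : C(Icc 0 m, ℝ) → ℝ → ℝ := fun u =>
    IccExtend hm.le ((Icc 0 m).domRestrict fun r => -weightedAverage Q (fun s => g (E u s)) r) with hN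
  have hNc : ∀ u, Continuous (N u) := fun u =>
    (continuousOn_iff_continuous_domRestrict.1
      (hQ.continuousOn_weightedAverage (hgc.comp (hEc u))).neg).Icc_extend'
  have hNeq : ∀ u, ∀ r ∈ Icc 0 m, N u r = -weightedAverage Q (fun s => g (E u s)) r := by
    intro u r hr
    rw [hN]
    simp only
    rw [IccExtend_of_mem _ _ hr]
    rfl
  have hNsub : ∀ u u', ∀ r ∈ Icc 0 m,
      |N u r - N u' r| ≤ K * dist u u' * (∫ s in (0 : ℝ)..r, Real.exp (κ * s)) := by
    intro u u' r hr
    rw [hNeq u r hr, hNeq u' r hr, neg_sub_neg, abs_sub_comm,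
      weightedAverage_sub hQ (f := fun s => g (E u s)) (g := fun s => g (E u' s))
        (hgc.comp (hEc u)) (hgc.comp (hEc u')),
      ← intervalIntegral.integral_const_mul]
    refine hQ.abs_weightedAverage_le (by fun_prop) hr fun s hs => ?_
    refine (hg _ _).trans ?_
    have := mul_le_mul_of_nonneg_left (hEsub u u' s) hK.le
    linarith
  have hexp : ∀ r : ℝ, (∫ s in (0 : ℝ)..r, Real.exp (κ * s)) ≤ Real.exp (κ * r) / κ := by
    intro r
    rw [intervalIntegral.integral_comp_mul_left (fun x => Real.exp x) hκ0.ne', integral_exp,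
      mul_zero, Real.exp_zero, smul_eq_mul, div_eq_inv_mul]
    exact mul_le_mul_of_nonneg_left (by linarith) (inv_nonneg.2 hκ0.le)
  set F : ℝ → C(Icc 0 m, ℝ) → ℝ → ℝ := fun α u r => α + ∫ s in (0 : ℝ)..r, N u s with hF
  have hFc : ∀ α u, Continuous (F α u) := fun α u =>
    continuous_const.add
      (intervalIntegral.continuous_primitive (fun _ _ => (hNc u).intervalIntegrable _ _) 0)
  -- The unknown is `u = exp (-κ r) w`. A fixed point encodes `w = α + ∫ v` with `v = -(∫ Q g(w)) /
  -- Q`, which builds in `v 0 = 0`.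
  set Φ : ℝ → C(Icc 0 m, ℝ) → C(Icc 0 m, ℝ) := fun α u =>
    ⟨fun r => Real.exp (-(κ * r)) * F α u r, by
      have := hFc α u
      fun_prop⟩ with hΦ
  have hint : ∀ u u', ∀ r ∈ Icc 0 m,
      |(∫ s in (0 : ℝ)..r, N u s) - ∫ s in (0 : ℝ)..r, N u' s|
        ≤ dist u u' / 2 * Real.exp (κ * r) := by
    intro u u' r hr
    rw [← intervalIntegral.integral_sub ((hNc u).intervalIntegrable _ _)
      ((hNc u').intervalIntegrable _ _), ← Real.norm_eq_abs]
    have h1 : ‖∫ s in (0 : ℝ)..r, (N u s - N u' s)‖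
        ≤ ∫ s in (0 : ℝ)..r, K * dist u u' / κ * Real.exp (κ * s) := by
      refine intervalIntegral.norm_integral_le_of_norm_le hr.1 (Eventually.of_forall ?_)
        (by fun_prop : Continuous fun s => K * dist u u' / κ * Real.exp (κ * s)).continuousOn.intervalIntegrable
      intro s hs
      refine (hNsub u u' s ⟨hs.1.le, hs.2.trans hr.2⟩).trans ?_
      have := mul_le_mul_of_nonneg_left (hexp s) (by positivity : 0 ≤ K * dist u u')
      refine this.trans (le_of_eq ?_)
      ring
    refine h1.trans ?_
    rw [intervalIntegral.integral_const_mul]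
    have h2 := mul_le_mul_of_nonneg_left (hexp r) (by positivity : 0 ≤ K * dist u u' / κ)
    refine h2.trans ?_
    have h3 : K / κ ^ 2 ≤ 1 / 2 := by
      rw [div_le_iff₀ (by positivity), hκ]; nlinarith
    have h4 := mul_le_mul_of_nonneg_right h3 (by positivity : 0 ≤ dist u u' * Real.exp (κ * r))
    calc K * dist u u' / κ * (Real.exp (κ * r) / κ)
        = K / κ ^ 2 * (dist u u' * Real.exp (κ * r)) := by field_simp
      _ ≤ _ := by linarith
  have hΦd : ∀ α β u u', dist (Φ α u) (Φ β u') ≤ |α - β| + dist u u' / 2 := by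
    intro α β u u'
    refine (ContinuousMap.dist_le (by positivity)).2 fun r => ?_
    have hr0 : (0 : ℝ) ≤ r := r.2.1
    rw [Real.dist_eq]
    simp only [hΦ, ContinuousMap.coe_mk, hF]
    rw [← mul_sub, abs_mul, abs_of_pos (Real.exp_pos _)]
    have h1 : |α + (∫ s in (0 : ℝ)..r, N u s) - (β + ∫ s in (0 : ℝ)..r, N u' s)|
        ≤ |α - β| + dist u u' / 2 * Real.exp (κ * r) := by
      rw [add_sub_add_comm]
      exact (abs_add_le _ _).trans (by gcongr; exact hint u u' r r.2)
    have h2 : Real.exp (-(κ * r)) ≤ 1 := Real.exp_le_one_iff.2 (by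
      have := mul_nonneg hκ0.le hr0
      linarith)
    have h3 : Real.exp (-(κ * r)) * Real.exp (κ * r) = 1 := by rw [← Real.exp_add]; simp
    calc _ ≤ Real.exp (-(κ * r)) * (|α - β| + dist u u' / 2 * Real.exp (κ * r)) :=
          mul_le_mul_of_nonneg_left h1 (Real.exp_pos _).le
      _ = Real.exp (-(κ * r)) * |α - β|
          + dist u u' / 2 * (Real.exp (-(κ * r)) * Real.exp (κ * r)) := by ring
      _ ≤ _ := by
          rw [h3, mul_one]
          nlinarith [abs_nonneg (α - β)]
  have hcontr : ∀ α, ContractingWith (1 / 2) (Φ α) := fun α =>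
    ⟨by norm_num, LipschitzWith.of_dist_le_mul fun u u' => by
      have := hΦd α α u u'
      simp only [sub_self, abs_zero, zero_add] at this
      refine this.trans (le_of_eq ?_)
      push_cast
      ring⟩
  have : Nonempty C(Icc 0 m, ℝ) := ⟨0⟩
  set U : ℝ → C(Icc 0 m, ℝ) := fun α => ContractingWith.fixedPoint (Φ α) (hcontr α) with hU
  have hfix : ∀ α, Φ α (U α) = U α := fun α => (hcontr α).fixedPoint_isFixedPt
  have hUd : ∀ α β, dist (U α) (U β) ≤ 2 * |α - β| := by
    intro α β
    have := hΦd α β (U α) (U β)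
    rw [hfix, hfix] at this
    linarith
  have hEF : ∀ α, ∀ r ∈ Icc 0 m, E (U α) r = F α (U α) r := by
    intro α r hr
    have h1 : U α ⟨r, hr⟩ = Real.exp (-(κ * r)) * F α (U α) r := by
      conv_lhs => rw [← hfix α]
      rfl
    have h3 : Real.exp (κ * r) * Real.exp (-(κ * r)) = 1 := by rw [← Real.exp_add]; simp
    rw [hE]
    simp only
    rw [IccExtend_of_mem _ _ hr, h1, ← mul_assoc, h3, one_mul]
  refine ⟨fun α => F α (U α), fun α => N (U α), fun α => ?_, ?_, ?_⟩
  · refine ⟨hFc _ _, hNc _, by simp [hF], ?_, ?_, ?_⟩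
    · beta_reduce
      rw [hNeq _ _ (left_mem_Icc.2 hm.le), weightedAverage_zero, neg_zero]
    · intro r _
      exact ((hNc (U α)).integral_hasStrictDerivAt 0 r).hasDerivAt.const_add α
    · intro r hr
      have h1 := (hQ.hasDerivAt_weightedAverage (f := fun s => g (E (U α) s))
        (hgc.comp (hEc _)) hr).neg
      have h2 : N (U α) =ᶠ[𝓝 r] -weightedAverage Q (fun s => g (E (U α) s)) := by
        filter_upwards [Icc_mem_nhds hr.1 hr.2] with s hs
        exact hNeq _ s hs
      refine (h1.congr_of_eventuallyEq h2).congr_deriv ?_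
      beta_reduce
      rw [hNeq _ r ⟨hr.1.le, hr.2.le⟩, ← hEF α r ⟨hr.1.le, hr.2.le⟩]
      ring
  · have hN0 : ∀ r ∈ Icc 0 m, N 0 r = 0 := by
      intro r hr
      rw [hNeq 0 r hr]
      simp [hE, hg0, weightedAverage, IccExtend]
    have hF0 : ∀ r ∈ Icc 0 m, F 0 0 r = 0 := by
      intro r hr
      simp only [hF, zero_add]
      rw [intervalIntegral.integral_congr (g := fun _ => 0)]
      · simp
      · intro s hs
        rw [uIcc_of_le hr.1] at hs
        exact hN0 s ⟨hs.1, hs.2.trans hr.2⟩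
    have hU0 : U 0 = 0 := by
      refine ((hcontr 0).fixedPoint_unique ?_).symm
      ext r
      simp [hΦ, hF0 r r.2]
    intro r hr
    simp only [hU0]
    exact ⟨hF0 r hr, hN0 r hr⟩
  · refine ⟨2 * Real.exp (κ * m) + 2 * K * (Real.exp (κ * m) / κ), by positivity,
      fun α β r hr => ⟨?_, ?_⟩⟩
    · beta_reduce
      rw [← hEF α r hr, ← hEF β r hr]
      refine (hEsub _ _ r).trans ?_
      have h1 : Real.exp (κ * r) ≤ Real.exp (κ * m) :=
        Real.exp_le_exp.2 (mul_le_mul_of_nonneg_left hr.2 hκ0.le)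
      calc _ ≤ Real.exp (κ * m) * (2 * |α - β|) :=
            mul_le_mul h1 (hUd α β) dist_nonneg (Real.exp_pos _).le
        _ ≤ _ := by
            have : 0 ≤ 2 * K * (Real.exp (κ * m) / κ) * |α - β| := by positivity
            linarith
    · refine (hNsub _ _ r hr).trans ?_
      have h1 : Real.exp (κ * r) ≤ Real.exp (κ * m) :=
        Real.exp_le_exp.2 (mul_le_mul_of_nonneg_left hr.2 hκ0.le)
      have h2 : (∫ s in (0 : ℝ)..r, Real.exp (κ * s)) ≤ Real.exp (κ * m) / κ :=
        (hexp r).trans (by gcongr)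
      calc _ ≤ K * (2 * |α - β|) * (Real.exp (κ * m) / κ) := by
            refine mul_le_mul (mul_le_mul_of_nonneg_left (hUd α β) hK.le) h2 ?_ (by positivity)
            exact intervalIntegral.integral_nonneg hr.1 fun s _ => (Real.exp_pos _).le
        _ ≤ _ := by
            have : 0 ≤ 2 * Real.exp (κ * m) * |α - β| := by positivity
            linarith

/-- Solutions of the truncated problem starting well inside the truncation solve the
untruncated problem. -/
theorem ShootSol.of_trunc (hp : 1 < p) (hQ : IsWeight Q q a m) {M : ℝ}
    (hM : ∀ x y : ℝ, |y| < |x| → M ≤ |x| → potential p μ y < potential p μ x) (hα : |α| < M)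
    (h : ShootSol q m (truncNonlin p μ M) α w v) :
    ShootSol q m (nonlin p μ) α w v ∧ ∀ r ∈ Icc 0 m, |w r| < M := by
  have key : ∀ T ≤ m, (∀ r ∈ Ioo 0 T, |w r| ≤ M) → ShootSol q T (nonlin p μ) α w v := by
    intro T hT hw
    refine ⟨h.cont, h.cont', h.init, h.init', fun r hr => h.deriv r ⟨hr.1, hr.2.trans_le hT⟩,
      fun r hr => ?_⟩
    have := h.deriv' r ⟨hr.1, hr.2.trans_le hT⟩
    rwa [truncNonlin_of_abs_le (hw r hr)] at this
  have hlt : ∀ r ∈ Icc 0 m, |w r| < M := by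
    by_contra! hex
    -- Up to the first exit time the truncation is inactive, so the energy bound applies there. It
    -- contradicts `|α| < M ≤ |w|` through `hM`.
    set S : Set ℝ := Icc 0 m ∩ {r | M ≤ |w r|} with hS
    have hSc : IsClosed S := isClosed_Icc.inter (isClosed_le continuous_const h.cont.abs)
    have hSb : BddBelow S := ⟨0, fun r hr => hr.1.1⟩
    have hSn : S.Nonempty := let ⟨r, hr, hr'⟩ := hex; ⟨r, hr, hr'⟩
    have hmem := hSc.csInf_mem hSn hSb
    set T := sInf S with hT
    have hsol := key T hmem.1.2 (by
      intro r hr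
      by_contra! hr'
      exact absurd (csInf_le hSb (show r ∈ S from
        ⟨⟨hr.1.le, hr.2.le.trans hmem.1.2⟩, hr'.le⟩)) (not_le.2 hr.2))
    exact absurd (hsol.potential_le hp hQ hmem.1.2 (right_mem_Icc.2 hmem.1.1))
      (not_le.2 (hM _ _ (hα.trans_le hmem.2) hmem.2))
  exact ⟨key m le_rfl fun r hr => (hlt r ⟨hr.1.le, hr.2.le⟩).le, hlt⟩

/-- The shooting family on a bounded range of initial values. -/
theorem IsWeight.exists_shooting_family (hQ : IsWeight Q q a m) (hp : 1 < p) (hμ : 0 < μ)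
    (A : ℝ) :
    ∃ W V : ℝ → ℝ → ℝ, (∀ α, |α| ≤ A → ShootSol q m (nonlin p μ) α (W α) (V α)) ∧
      (∀ r ∈ Icc 0 m, W 0 r = 0 ∧ V 0 r = 0) ∧
      ∃ C, 0 < C ∧ ∀ α β, ∀ r ∈ Icc 0 m,
        |W α r - W β r| ≤ C * |α - β| ∧ |V α r - V β r| ≤ C * |α - β| := by
  obtain ⟨C₀, hC₀, hpot⟩ := exists_potential_lt (p := p) (μ := μ) hp hμ
  -- `A + 1` keeps every admissible initial value strictly inside the truncation.
  set M := max C₀ (A + 1) with hM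
  obtain ⟨K, hK, hlip⟩ := exists_lipschitz_truncNonlin (p := p) (μ := μ) hp hμ
    (M := M) (by linarith [le_max_left C₀ (A + 1)])
  have hM0 : 0 ≤ M := by linarith [le_max_left C₀ (A + 1)]
  obtain ⟨W, V, hsol, h0, hC⟩ := hQ.exists_family hK hlip
    (by rw [truncNonlin_of_abs_le (by simpa using hM0), nonlin_zero])
  refine ⟨W, V, fun α hα => (ShootSol.of_trunc hp hQ (fun x y hxy hx =>
    hpot x y hxy ((le_max_left _ _).trans hx)) (M := M) ?_ (hsol α)).1, h0, hC⟩
  linarith [le_max_right C₀ (A + 1)]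

end NodalYamabe

/-! ### Uniqueness, and the phase of a solution. -/

namespace NodalYamabe

variable {Q q w v : ℝ → ℝ} {a : ℕ} {m p μ α : ℝ}

/-- A nonnegative function with `|f'| ≤ K f` and a zero vanishes identically. -/
theorem eq_zero_of_abs_deriv_le {f f' : ℝ → ℝ} {c d K x₀ : ℝ} (hf : ContinuousOn f (Icc c d))
    (hf' : ∀ r ∈ Ioo c d, HasDerivAt f (f' r) r) (h0 : ∀ r ∈ Icc c d, 0 ≤ f r)
    (hb : ∀ r ∈ Ioo c d, |f' r| ≤ K * f r) (hx₀ : x₀ ∈ Icc c d) (hfx : f x₀ = 0) :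
    ∀ r ∈ Icc c d, f r = 0 := by
  -- Integrating factors `exp (±K r)` carry the zero to the left and to the right of `x₀`
  -- respectively.
  have hd : ∀ k : ℝ, ∀ r ∈ Ioo c d, HasDerivAt (fun r => f r * Real.exp (k * r))
      ((f' r + k * f r) * Real.exp (k * r)) r := by
    intro k r hr
    refine ((hf' r hr).mul (((hasDerivAt_id r).const_mul k).exp)).congr_deriv ?_
    simp
    ring
  have hc : ∀ k : ℝ, ContinuousOn (fun r => f r * Real.exp (k * r)) (Icc c d) := fun k =>
    hf.mul (by fun_prop)
  have hmono : MonotoneOn (fun r => f r * Real.exp (K * r)) (Icc c d) := by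
    refine monotoneOn_of_deriv_nonneg (convex_Icc _ _) (hc K) ?_ ?_ <;> rw [interior_Icc]
    · exact fun r hr => (hd K r hr).differentiableAt.differentiableWithinAt
    · intro r hr
      rw [(hd K r hr).deriv]
      have := (abs_le.1 (hb r hr)).1
      exact mul_nonneg (by linarith) (Real.exp_pos _).le
  have hanti : AntitoneOn (fun r => f r * Real.exp (-K * r)) (Icc c d) := by
    refine antitoneOn_of_deriv_nonpos (convex_Icc _ _) (hc (-K)) ?_ ?_ <;> rw [interior_Icc]
    · exact fun r hr => (hd (-K) r hr).differentiableAt.differentiableWithinAt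
    · intro r hr
      rw [(hd (-K) r hr).deriv]
      have := (abs_le.1 (hb r hr)).2
      exact mul_nonpos_of_nonpos_of_nonneg (by linarith) (Real.exp_pos _).le
  intro r hr
  refine le_antisymm ?_ (h0 r hr)
  rcases le_total r x₀ with h | h
  · have := hmono hr hx₀ h
    simp only [hfx, zero_mul] at this
    exact nonpos_of_mul_nonpos_left this (Real.exp_pos _)
  · have := hanti hx₀ hr h
    simp only [hfx, zero_mul] at this
    exact nonpos_of_mul_nonpos_left this (Real.exp_pos _)

/-- A solution that touches an equilibrium with zero derivative is constant. -/
theorem eq_const_of_touch (hp : 1 < p) (hμ : 0 < μ) {c d e q₀ x₀ : ℝ}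
    (hw : ContinuousOn w (Icc c d)) (hv : ContinuousOn v (Icc c d))
    (hw' : ∀ r ∈ Ioo c d, HasDerivAt w (v r) r)
    (hv' : ∀ r ∈ Ioo c d, HasDerivAt v (-(q r * v r) - nonlin p μ (w r)) r)
    (hq : ∀ r ∈ Ioo c d, |q r| ≤ q₀) (he : nonlin p μ e = 0)
    (hx₀ : x₀ ∈ Icc c d) (hwx : w x₀ = e) (hvx : v x₀ = 0) :
    ∀ r ∈ Icc c d, w r = e ∧ v r = 0 := by
  obtain ⟨M, hM⟩ := isCompact_Icc.exists_bound_of_continuousOn hw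
  obtain ⟨K, hK, hlip⟩ := exists_lipschitz_nonlin (p := p) (μ := μ) hp hμ M
  have key := eq_zero_of_abs_deriv_le (f := fun r => (w r - e) ^ 2 + v r ^ 2)
    (f' := fun r => 2 * (w r - e) * v r + 2 * v r * (-(q r * v r) - nonlin p μ (w r)))
    (K := 1 + 2 * q₀ + K) (((hw.sub continuousOn_const).pow 2).add (hv.pow 2))
    (fun r hr => by
      refine ((((hw' r hr).sub_const e).pow 2).add ((hv' r hr).pow 2)).congr_deriv ?_
      push_cast
      ring)
    (fun r _ => by positivity)
    (fun r hr => by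
      have h1 := hlip (w r) e (hM r ⟨hr.1.le, hr.2.le⟩) (hwx ▸ hM x₀ hx₀)
      rw [he, sub_zero] at h1
      have h2 := hq r hr
      set y := w r - e
      set z := v r
      set γ := nonlin p μ (w r)
      have h3 : |2 * y * z| ≤ y ^ 2 + z ^ 2 := by
        rw [abs_le]; constructor <;> nlinarith [sq_nonneg (y + z), sq_nonneg (y - z)]
      have h4 : |2 * z * (q r * z)| ≤ 2 * q₀ * z ^ 2 := by
        rw [show 2 * z * (q r * z) = q r * (2 * z ^ 2) by ring, abs_mul,
          abs_of_nonneg (by positivity : 0 ≤ 2 * z ^ 2)]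
        nlinarith [mul_le_mul_of_nonneg_right h2 (by positivity : 0 ≤ 2 * z ^ 2)]
      have h5 : |2 * z * γ| ≤ K * (y ^ 2 + z ^ 2) := by
        rw [abs_mul, abs_mul, abs_two]
        have h6 : 2 * |z| * |γ| ≤ 2 * |z| * (K * |y|) :=
          mul_le_mul_of_nonneg_left h1 (by positivity)
        have h7 : 2 * |z| * |y| ≤ y ^ 2 + z ^ 2 := by
          nlinarith [sq_nonneg (|z| - |y|), sq_abs z, sq_abs y]
        nlinarith [mul_le_mul_of_nonneg_left h7 hK.le]
      have hq0 : 0 ≤ q₀ := (abs_nonneg _).trans h2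
      calc |2 * y * z + 2 * z * (-(q r * z) - γ)|
          = |2 * y * z - 2 * z * (q r * z) - 2 * z * γ| := by congr 1; ring
        _ ≤ |2 * y * z| + |2 * z * (q r * z)| + |2 * z * γ| :=
            (abs_sub _ _).trans (add_le_add_left (abs_sub _ _) _)
        _ ≤ _ := by nlinarith [mul_nonneg hq0 (sq_nonneg y)])
    hx₀ (by simp [hwx, hvx])
  intro r hr
  have := key r hr
  have h1 : (w r - e) ^ 2 = 0 := by nlinarith [sq_nonneg (w r - e), sq_nonneg (v r)]
  have h2 : v r ^ 2 = 0 := by nlinarith [sq_nonneg (w r - e), sq_nonneg (v r)]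
  exact ⟨sub_eq_zero.1 (pow_eq_zero_iff two_ne_zero |>.1 h1), pow_eq_zero_iff two_ne_zero |>.1 h2⟩

/-- The phase point `w + i Q w'`. -/
noncomputable def phase (Q w v : ℝ → ℝ) (r : ℝ) : ℂ := ⟨w r, Q r * v r⟩

/-- The coefficient `q` is bounded away from the origin, so a vanishing phase at `r > 0` forces `w =
0` on all of `(0, r)`. By continuity this contradicts the initial value. -/
theorem ShootSol.phase_ne_zero (hp : 1 < p) (hμ : 0 < μ) (hQ : IsWeight Q q a m)
    (h : ShootSol q m (nonlin p μ) α w v) (hα : α ≠ 0) {r : ℝ} (hr : r ∈ Icc 0 m) :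
    phase Q w v r ≠ 0 := by
  intro hz
  have hw : w r = 0 := congrArg Complex.re hz
  have hv : Q r * v r = 0 := congrArg Complex.im hz
  rcases hr.1.eq_or_lt with rfl | h0
  · exact hα (h.init.symm.trans hw)
  have hv' : v r = 0 := (mul_eq_zero.1 hv).resolve_left (hQ.pos r ⟨h0, hr.2⟩).ne'
  have hzero : ∀ s ∈ Ioo 0 r, w s = 0 := by
    intro s hs
    obtain ⟨q₀, hq₀⟩ := (isCompact_Icc (a := s) (b := r)).exists_bound_of_continuousOn
      (hQ.contOn.mono fun t ht => ⟨hs.1.trans_le ht.1, ht.2.trans hr.2⟩)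
    have hsub : ∀ t ∈ Ioo s r, t ∈ Ioo 0 m := fun t ht => ⟨hs.1.trans ht.1, ht.2.trans_le hr.2⟩
    exact (eq_const_of_touch hp hμ h.cont.continuousOn h.cont'.continuousOn
      (fun t ht => h.deriv t (hsub t ht)) (fun t ht => h.deriv' t (hsub t ht))
      (fun t ht => hq₀ t ⟨ht.1.le, ht.2.le⟩) nonlin_zero (right_mem_Icc.2 hs.2.le) hw hv'
      s (left_mem_Icc.2 hs.2.le)).1
  have h1 : Tendsto w (𝓝[>] 0) (𝓝 α) := by
    rw [← h.init]; exact h.cont.continuousAt.tendsto.mono_left nhdsWithin_le_nhds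
  have h2 : Tendsto w (𝓝[>] 0) (𝓝 0) := tendsto_const_nhds.congr' (by
    filter_upwards [Ioo_mem_nhdsGT h0] with s hs using (hzero s hs).symm)
  exact hα (tendsto_nhds_unique h1 h2)

/-- `L` is a continuous logarithm of the phase point along a solution, real at the origin. -/
structure IsPhaseLog (Q w v : ℝ → ℝ) (m : ℝ) (L : ℝ → ℂ) : Prop where
  cont : Continuous L
  exp_eq : ∀ r ∈ Icc 0 m, Complex.exp (L r) = phase Q w v r
  init : (L 0).im = 0

namespace IsPhaseLog

variable {L : ℝ → ℂ}

theorem cont_im (hL : IsPhaseLog Q w v m L) : Continuous fun r => (L r).im :=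
  Complex.continuous_im.comp hL.cont

theorem eq_cos (hL : IsPhaseLog Q w v m L) {r : ℝ} (hr : r ∈ Icc 0 m) :
    w r = Real.exp (L r).re * Real.cos (L r).im := by
  rw [← Complex.exp_re, hL.exp_eq r hr]; rfl

theorem eq_sin (hL : IsPhaseLog Q w v m L) {r : ℝ} (hr : r ∈ Icc 0 m) :
    Q r * v r = Real.exp (L r).re * Real.sin (L r).im := by
  rw [← Complex.exp_im, hL.exp_eq r hr]; rfl

theorem eq_zero_iff (hL : IsPhaseLog Q w v m L) {r : ℝ} (hr : r ∈ Icc 0 m) :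
    w r = 0 ↔ ∃ j : ℤ, (L r).im = (2 * j + 1) * Real.pi / 2 := by
  rw [hL.eq_cos hr, mul_eq_zero, or_iff_right (Real.exp_pos _).ne', Real.cos_eq_zero_iff]

/-- Near `r`, continuity pins the branch: `L` equals `L r` plus the principal logarithm of the phase
quotient, which is close to `1`. -/
theorem hasDerivAt (hL : IsPhaseLog Q w v m L) (hQ : IsWeight Q q a m) {g : ℝ → ℝ}
    (h : ShootSol q m g α w v) {r : ℝ} (hr : r ∈ Ioo 0 m) :
    HasDerivAt L ((⟨v r, -(Q r * g (w r))⟩ : ℂ) / phase Q w v r) r := by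
  have hrI : r ∈ Icc 0 m := ⟨hr.1.le, hr.2.le⟩
  have hne : phase Q w v r ≠ 0 := by rw [← hL.exp_eq r hrI]; exact Complex.exp_ne_zero _
  have hz : HasDerivAt (phase Q w v) (⟨v r, -(Q r * g (w r))⟩ : ℂ) r := by
    have h1 := (h.deriv r hr).ofReal_comp.add
      ((h.hasDerivAt_flux hQ le_rfl hr).ofReal_comp.mul_const Complex.I)
    refine (h1.congr_of_eventuallyEq (Eventually.of_forall fun s => ?_)).congr_deriv ?_
    · apply Complex.ext <;> simp [phase]
    · apply Complex.ext <;> simp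
  have h2 : HasDerivAt (fun s => Complex.log (phase Q w v s / phase Q w v r))
      ((⟨v r, -(Q r * g (w r))⟩ : ℂ) / phase Q w v r) r := by
    have := (hz.div_const (phase Q w v r)).clog_real (by rw [div_self hne]; simp)
    rwa [div_self hne, div_one] at this
  have h3 : L =ᶠ[𝓝 r] fun s => L r + Complex.log (phase Q w v s / phase Q w v r) := by
    have h4 : Tendsto (fun s => (L s - L r).im) (𝓝 r) (𝓝 0) := by
      have := (Complex.continuous_im.comp (hL.cont.sub continuous_const) :
        Continuous fun s => (L s - L r).im).tendsto r
      simpa [Function.comp_def] using this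
    filter_upwards [h4 (Ioo_mem_nhds (neg_lt_zero.2 Real.pi_pos) Real.pi_pos),
      Icc_mem_nhds hr.1 hr.2] with s hs hsI
    rw [← hL.exp_eq s hsI, ← hL.exp_eq r hrI, ← Complex.exp_sub, Complex.log_exp hs.1 hs.2.le]
    ring
  exact (h2.const_add (L r)).congr_of_eventuallyEq h3

theorem hasDerivAt_im (hL : IsPhaseLog Q w v m L) (hQ : IsWeight Q q a m) {g : ℝ → ℝ}
    (h : ShootSol q m g α w v) {r : ℝ} (hr : r ∈ Ioo 0 m) :
    HasDerivAt (fun s => (L s).im) ((⟨v r, -(Q r * g (w r))⟩ : ℂ) / phase Q w v r).im r := by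
  have := (Complex.imCLM.hasFDerivAt (x := L r)).comp_hasDerivAt r (hL.hasDerivAt hQ h hr)
  exact this

/-- On the imaginary axis the contribution of `g` to the logarithmic derivative is real, and the
remaining imaginary part is `-1 / Q`. Crossings of that axis therefore all go the same way, whatever
the nonlinearity. -/
theorem deriv_im_neg (hL : IsPhaseLog Q w v m L) (hQ : IsWeight Q q a m) (g : ℝ → ℝ)
    {r : ℝ} (hr : r ∈ Ioo 0 m) (hw : w r = 0) :
    ((⟨v r, -(Q r * g (w r))⟩ : ℂ) / phase Q w v r).im < 0 := by
  have hrI : r ∈ Icc 0 m := ⟨hr.1.le, hr.2.le⟩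
  have hQr := hQ.pos r ⟨hr.1, hr.2.le⟩
  have hne : phase Q w v r ≠ 0 := by rw [← hL.exp_eq r hrI]; exact Complex.exp_ne_zero _
  have hv : v r ≠ 0 := by
    intro hv
    exact hne (Complex.ext hw (by simp [phase, hv]))
  rw [Complex.div_im]
  simp only [phase, hw, Complex.normSq_mk, mul_zero, zero_div, zero_sub, zero_add]
  rw [neg_lt_zero]
  have h1 : 0 < v r ^ 2 := by positivity
  apply div_pos <;> nlinarith [mul_pos hQr h1, mul_pos (mul_pos hQr hQr) h1]

/-- Odd multiples of `π / 2` are the arguments at zeros of `w`, where the argument strictly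
decreases; it can never climb back through such a level. -/
theorem barrier (hL : IsPhaseLog Q w v m L) (hQ : IsWeight Q q a m) {g : ℝ → ℝ}
    (h : ShootSol q m g α w v) (j : ℤ) {r s : ℝ} (hr : 0 < r) (hrs : r ≤ s) (hs : s ≤ m)
    (hle : (L r).im ≤ (2 * j + 1) * Real.pi / 2) : (L s).im ≤ (2 * j + 1) * Real.pi / 2 := by
  refine image_le_of_deriv_right_lt_deriv_boundary (f := fun s => (L s).im)
    (B := fun _ => (2 * j + 1) * Real.pi / 2) (B' := fun _ => 0)
    (a := r) (b := s) hL.cont_im.continuousOn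
    (fun x hx => (hL.hasDerivAt_im hQ h ⟨hr.trans_le hx.1, hx.2.trans_le hs⟩).hasDerivWithinAt)
    hle (fun x => hasDerivAt_const x _) ?_ (right_mem_Icc.2 hrs)
  intro x hx hx'
  have hxI : x ∈ Ioo 0 m := ⟨hr.trans_le hx.1, hx.2.trans_le hs⟩
  exact hL.deriv_im_neg hQ g hxI ((hL.eq_zero_iff ⟨hxI.1.le, hxI.2.le⟩).2 ⟨j, hx'⟩)

/-- If the level were attained at `s`, the negative derivative would place the argument above it
just before `s`, against `barrier`. -/
theorem barrier_strict (hL : IsPhaseLog Q w v m L) (hQ : IsWeight Q q a m) {g : ℝ → ℝ}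
    (h : ShootSol q m g α w v) (j : ℤ) {r s : ℝ} (hr : 0 < r) (hrs : r < s) (hs : s < m)
    (hle : (L r).im ≤ (2 * j + 1) * Real.pi / 2) : (L s).im < (2 * j + 1) * Real.pi / 2 := by
  refine lt_of_le_of_ne (hL.barrier hQ h j hr hrs.le hs.le hle) fun heq => ?_
  have hsI : s ∈ Ioo 0 m := ⟨hr.trans hrs, hs⟩
  have hneg := hL.deriv_im_neg hQ g hsI ((hL.eq_zero_iff ⟨hsI.1.le, hsI.2.le⟩).2 ⟨j, heq⟩)
  have h1 := (hL.hasDerivAt_im hQ h hsI).tendsto_slope.mono_left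
    (nhdsWithin_mono s (fun x (hx : x ∈ Iio s) => ne_of_lt hx))
  obtain ⟨x, hx, hx'⟩ := ((h1.eventually_lt_const hneg).and (Ioo_mem_nhdsLT hrs)).exists
  rw [slope_def_field, div_neg_iff] at hx
  have h2 := hL.barrier hQ h j hr hx'.1.le (hx'.2.trans hs).le hle
  rcases hx with hx | hx <;> linarith [hx'.2, hx.1, hx.2]

theorem im_lt (hL : IsPhaseLog Q w v m L) (hQ : IsWeight Q q a m) {g : ℝ → ℝ}
    (h : ShootSol q m g α w v) {s : ℝ} (hs0 : 0 < s) (hs : s < m) : (L s).im < Real.pi / 2 := by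
  have h1 : ∀ᶠ r in 𝓝[>] (0 : ℝ), (L r).im < Real.pi / 2 := by
    have := hL.cont_im.tendsto 0
    rw [hL.init] at this
    exact (this.mono_left nhdsWithin_le_nhds).eventually_lt_const (by positivity)
  obtain ⟨r, hr, hr'⟩ := (h1.and (Ioo_mem_nhdsGT hs0)).exists
  have := hL.barrier_strict hQ h 0 hr'.1 hr'.2 hs (by push_cast; linarith)
  push_cast at this
  linarith

theorem im_end_le (hL : IsPhaseLog Q w v m L) (hQ : IsWeight Q q a m) {g : ℝ → ℝ}
    (h : ShootSol q m g α w v) : (L m).im ≤ Real.pi / 2 := by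
  have hm := hQ.pos_length
  have h1 := hL.im_lt hQ h (half_pos hm) (half_lt_self hm)
  have := hL.barrier hQ h 0 (half_pos hm) (half_le_self hm.le) le_rfl (by push_cast; linarith)
  push_cast at this
  linarith

/-- Each zero costs half a turn. -/
theorem im_le_of_zeros (hL : IsPhaseLog Q w v m L) (hQ : IsWeight Q q a m) {g : ℝ → ℝ}
    (h : ShootSol q m g α w v) {x : ℕ → ℝ} {n : ℕ} (hx : ∀ i ≤ n, x i ∈ Ioo 0 m)
    (hmono : ∀ i < n, x i < x (i + 1)) (hz : ∀ i ≤ n, w (x i) = 0) :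
    ∀ i ≤ n, (L (x i)).im ≤ -Real.pi / 2 - i * Real.pi := by
  have hpi := Real.pi_pos
  have step : ∀ i ≤ n, ∀ k : ℤ, (L (x i)).im < (2 * k + 1) * Real.pi / 2 →
      (L (x i)).im ≤ (2 * (k - 1 : ℤ) + 1) * Real.pi / 2 := by
    intro i hi k hk
    obtain ⟨j, hj⟩ := (hL.eq_zero_iff ⟨(hx i hi).1.le, (hx i hi).2.le⟩).1 (hz i hi)
    rw [hj] at hk ⊢
    have h1 : (j : ℝ) < k := by nlinarith
    have h2 : j ≤ k - 1 := by have : j < k := by exact_mod_cast h1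
                              omega
    have h3 : (j : ℝ) ≤ ((k - 1 : ℤ) : ℝ) := by exact_mod_cast h2
    nlinarith
  intro i
  induction i with
  | zero =>
    intro hi
    have h1 := step 0 hi 0 (by
      have := hL.im_lt hQ h (hx 0 hi).1 (hx 0 hi).2
      push_cast
      linarith)
    push_cast at h1 ⊢
    linarith
  | succ i ih =>
    intro hi
    have h1 := ih (by omega)
    have h2 := hL.barrier_strict hQ h (-1 - i) (hx i (by omega)).1 (hmono i (by omega))
      (hx (i + 1) hi).2 (by push_cast; linarith)
    have h3 := step (i + 1) hi (-1 - i) h2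
    push_cast at h3 ⊢
    linarith

/-- Conversely, a winding of `K` half turns produces `K` zeros. -/
theorem exists_zeros (hL : IsPhaseLog Q w v m L) (hm : 0 < m) {K : ℕ}
    (hK : (L m).im ≤ -(K * Real.pi)) :
    ∃ Z : Finset ℝ, Z.card = K ∧ ∀ r ∈ Z, r ∈ Ioo 0 m ∧ w r = 0 := by
  have hpi := Real.pi_pos
  have hex : ∀ i : Fin K, ∃ r ∈ Ioo 0 m, (L r).im = -Real.pi / 2 - (i : ℕ) * Real.pi := by
    intro i
    have hi : ((i : ℕ) : ℝ) + 1 ≤ K := by exact_mod_cast i.2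
    have h1 : -Real.pi / 2 - (i : ℕ) * Real.pi ∈ Ioo (L m).im (L 0).im := by
      rw [hL.init]
      constructor <;> nlinarith [(Nat.cast_nonneg (i : ℕ) : (0 : ℝ) ≤ (i : ℕ))]
    obtain ⟨r, hr, hr'⟩ := intermediate_value_Ioo' hm.le hL.cont_im.continuousOn h1
    exact ⟨r, hr, hr'⟩
  choose x hx hx' using hex
  have hinj : Function.Injective x := by
    intro i j hij
    have h1 : (L (x i)).im = (L (x j)).im := by rw [hij]
    rw [hx', hx'] at h1
    have h2 : ((i : ℕ) : ℝ) = (j : ℕ) := by nlinarith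
    exact Fin.ext (by exact_mod_cast h2)
  refine ⟨Finset.univ.map ⟨x, hinj⟩, by simp, fun r hr => ?_⟩
  obtain ⟨i, -, rfl⟩ := Finset.mem_map.1 hr
  refine ⟨hx i, (hL.eq_zero_iff ⟨(hx i).1.le, (hx i).2.le⟩).2 ⟨-1 - (i : ℕ), ?_⟩⟩
  rw [show (L _).im = _ from hx' i]
  push_cast
  ring

theorem exists_neg (hL : IsPhaseLog Q w v m L) (hm : 0 < m) (hK : (L m).im ≤ -Real.pi) :
    ∃ r ∈ Icc 0 m, w r < 0 := by
  have hpi := Real.pi_pos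
  obtain ⟨r, hr, hr'⟩ := intermediate_value_Icc' hm.le hL.cont_im.continuousOn
    (show -Real.pi ∈ Icc (L m).im (L 0).im by rw [hL.init]; exact ⟨hK, by linarith⟩)
  refine ⟨r, hr, ?_⟩
  rw [hL.eq_cos hr, show (L r).im = _ from hr', Real.cos_neg, Real.cos_pi]
  linarith [Real.exp_pos (L r).re]

theorem im_gt_of_pos (hL : IsPhaseLog Q w v m L) (hm : 0 < m) (hw : ∀ r ∈ Icc 0 m, 0 < w r) :
    -Real.pi / 2 < (L m).im := by
  by_contra! hle
  have hpi := Real.pi_pos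
  obtain ⟨r, hr, hr'⟩ := intermediate_value_Icc' hm.le hL.cont_im.continuousOn
    (show -Real.pi / 2 ∈ Icc (L m).im (L 0).im by rw [hL.init]; exact ⟨hle, by linarith⟩)
  refine (hw r hr).ne' ((hL.eq_zero_iff hr).2 ⟨-1, ?_⟩)
  simp only at hr'
  rw [hr']
  push_cast
  ring

end IsPhaseLog

/-- Solutions that stay below `1` in absolute value and start positive stay positive. -/
theorem ShootSol.pos_of_abs_le_one (hp : 1 < p) (hμ : 0 < μ) (hQ : IsWeight Q q a m)
    (h : ShootSol q m (nonlin p μ) α w v) (hα : 0 < α) (hw : ∀ r ∈ Icc 0 m, |w r| ≤ 1) :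
    ∀ r ∈ Icc 0 m, 0 < w r := by
  by_contra! hex
  set S : Set ℝ := Icc 0 m ∩ {r | w r ≤ 0} with hS
  have hSc : IsClosed S := isClosed_Icc.inter (isClosed_le h.cont continuous_const)
  have hSb : BddBelow S := ⟨0, fun r hr => hr.1.1⟩
  have hSn : S.Nonempty := let ⟨r, hr, hr'⟩ := hex; ⟨r, hr, hr'⟩
  have hmem := hSc.csInf_mem hSn hSb
  set T := sInf S with hT
  have hpos : ∀ r ∈ Ico 0 T, 0 < w r := by
    intro r hr
    by_contra! hr'
    exact absurd (csInf_le hSb (show r ∈ S from ⟨⟨hr.1, hr.2.le.trans hmem.1.2⟩, hr'⟩))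
      (not_le.2 hr.2)
  -- Before the first nonpositive value, `0 < w ≤ 1` makes `g(w) ≤ 0`. The flux then increases from
  -- zero, so `w` increases and cannot come down to zero.
  have hflux : MonotoneOn (fun s => Q s * v s) (Icc 0 T) := by
    refine monotoneOn_of_deriv_nonneg (convex_Icc _ _) (hQ.cont.mul h.cont').continuousOn ?_ ?_ <;>
      rw [interior_Icc]
    · exact fun r hr => (h.hasDerivAt_flux hQ le_rfl
        ⟨hr.1, hr.2.trans_le hmem.1.2⟩).differentiableAt.differentiableWithinAt
    · intro r hr
      have hrm : r ∈ Ioo 0 m := ⟨hr.1, hr.2.trans_le hmem.1.2⟩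
      rw [(h.hasDerivAt_flux hQ le_rfl hrm).deriv]
      have h1 := nonlin_nonpos hp hμ (hw r ⟨hrm.1.le, hrm.2.le⟩) (hpos r ⟨hr.1.le, hr.2⟩).le
      have h2 := hQ.pos r ⟨hrm.1, hrm.2.le⟩
      nlinarith
  have hmono : MonotoneOn w (Icc 0 T) := by
    refine monotoneOn_of_deriv_nonneg (convex_Icc _ _) h.cont.continuousOn ?_ ?_ <;>
      rw [interior_Icc]
    · exact fun r hr => (h.deriv r
        ⟨hr.1, hr.2.trans_le hmem.1.2⟩).differentiableAt.differentiableWithinAt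
    · intro r hr
      have hrm : r ∈ Ioo 0 m := ⟨hr.1, hr.2.trans_le hmem.1.2⟩
      rw [(h.deriv r hrm).deriv]
      have h1 := hflux (left_mem_Icc.2 (hr.1.trans hr.2).le) ⟨hr.1.le, hr.2.le⟩ hr.1.le
      simp only [h.init', mul_zero] at h1
      exact nonneg_of_mul_nonneg_right h1 (hQ.pos r ⟨hrm.1, hrm.2.le⟩)
  have h1 := hmono (left_mem_Icc.2 hmem.1.1) (right_mem_Icc.2 hmem.1.1) hmem.1.1
  rw [h.init] at h1
  exact absurd hmem.2 (not_le.2 (hα.trans_le h1))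

end NodalYamabe

/-! ### Continuous phase logarithms and unbounded winding. -/

namespace NodalYamabe

variable {Q q w v : ℝ → ℝ} {a : ℕ} {m p μ α : ℝ}

theorem isSimplyConnected_of_convex {X : Type*} [AddCommGroup X] [Module ℝ X]
    [TopologicalSpace X] [ContinuousAdd X] [ContinuousSMul ℝ X] {s : Set X}
    (hs : Convex ℝ s) (hne : s.Nonempty) : IsSimplyConnected s := by
  have := hs.contractibleSpace hne
  exact SimplyConnectedSpace.ofContractible s

/-- The shooting family together with logarithms of the phase depending continuously on the
initial value. -/
theorem IsWeight.exists_phaseLog_family (hQ : IsWeight Q q a m) (hp : 1 < p) (hμ : 0 < μ)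
    {A : ℝ} (hA : 0 < A) :
    ∃ (W V : ℝ → ℝ → ℝ) (L : ℝ → ℝ → ℂ),
      (∀ α ∈ Ioc 0 A, ShootSol q m (nonlin p μ) α (W α) (V α) ∧
        IsPhaseLog Q (W α) (V α) m (L α)) ∧
      ContinuousOn (fun α => L α m) (Ioc 0 A) ∧
      (∃ δ > 0, ∀ α ∈ Ioc 0 A, α ≤ δ → -Real.pi / 2 < (L α m).im) ∧
      ∀ c : ℝ, ∃ δ > 0, ∀ α ∈ Ioc 0 A, α ≤ δ → (L α m).re < c := by
  have hm := hQ.pos_length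
  obtain ⟨W, V, hsol, h0, C, hC, hlip⟩ := hQ.exists_shooting_family hp hμ A
  have hsol' : ∀ α ∈ Ioc 0 A, ShootSol q m (nonlin p μ) α (W α) (V α) := fun α hα =>
    hsol α (abs_le.2 ⟨by linarith [hα.1], hα.2⟩)
  -- Clamping both variables extends the family to `(0, ∞) × ℝ`, which is open and convex as the
  -- lifting theorem requires. The uniform Lipschitz bound in `α` upgrades separate continuity to
  -- joint continuity.
  have hjoint : ∀ F : ℝ → ℝ → ℝ, (∀ α ∈ Ioc 0 A, Continuous (F α)) →
      (∀ α β, ∀ r ∈ Icc 0 m, |F α r - F β r| ≤ C * |α - β|) →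
      ContinuousOn (fun x : ℝ × ℝ => F (min x.1 A) (projIcc 0 m hm.le x.2)) (Ioi 0 ×ˢ univ) := by
    intro F hF hFl x hx
    have hxα : min x.1 A ∈ Ioc 0 A := ⟨lt_min hx.1 hA, min_le_right _ _⟩
    have h1 : Tendsto (fun y : ℝ × ℝ => C * |min y.1 A - min x.1 A|
        + |F (min x.1 A) (projIcc 0 m hm.le y.2) - F (min x.1 A) (projIcc 0 m hm.le x.2)|)
        (𝓝 x) (𝓝 0) := by
      have hc : Continuous fun y : ℝ × ℝ => C * |min y.1 A - min x.1 A|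
          + |F (min x.1 A) (projIcc 0 m hm.le y.2) - F (min x.1 A) (projIcc 0 m hm.le x.2)| := by
        have := hF _ hxα
        fun_prop
      have := hc.tendsto x
      simpa using this
    refine tendsto_iff_norm_sub_tendsto_zero.2 (squeeze_zero (fun _ => norm_nonneg _) (fun y => ?_)
      (h1.mono_left nhdsWithin_le_nhds))
    rw [Real.norm_eq_abs]
    refine (abs_sub_le _ (F (min x.1 A) (projIcc 0 m hm.le y.2)) _).trans ?_
    exact add_le_add_left (hFl _ _ _ (projIcc 0 m hm.le y.2).2) _
  have hWc := hjoint W (fun α hα => (hsol' α hα).cont) fun α β r hr => (hlip α β r hr).1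
  have hVc := hjoint V (fun α hα => (hsol' α hα).cont') fun α β r hr => (hlip α β r hr).2
  set U : Set (ℝ × ℝ) := Ioi 0 ×ˢ univ with hU
  set z : ℝ × ℝ → ℂ := fun x => phase Q (W (min x.1 A)) (V (min x.1 A)) (projIcc 0 m hm.le x.2)
    with hz
  have hzc : ContinuousOn z U := by
    have h1 : ContinuousOn (fun x : ℝ × ℝ => ((W (min x.1 A) (projIcc 0 m hm.le x.2) : ℝ) : ℂ)
        + ((Q (projIcc 0 m hm.le x.2) * V (min x.1 A) (projIcc 0 m hm.le x.2) : ℝ) : ℂ)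
          * Complex.I) U := by
      have hQc : ContinuousOn (fun x : ℝ × ℝ => Q (projIcc 0 m hm.le x.2)) U := by
        have := hQ.cont
        fun_prop
      exact (Complex.continuous_ofReal.comp_continuousOn hWc).add
        ((Complex.continuous_ofReal.comp_continuousOn (hQc.mul hVc)).mul continuousOn_const)
    refine h1.congr fun x _ => ?_
    apply Complex.ext <;> simp [hz, phase]
  have hUo : IsOpen U := isOpen_Ioi.prod isOpen_univ
  have hUs : IsSimplyConnected U :=
    isSimplyConnected_of_convex ((convex_Ioi 0).prod convex_univ) ⟨(1, 0), mem_Ioi.2 one_pos, mem_univ _⟩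
  have hz0 : 0 ∉ z '' U := by
    rintro ⟨x, hx, hx'⟩
    have hxα : min x.1 A ∈ Ioc 0 A := ⟨lt_min hx.1 hA, min_le_right _ _⟩
    exact (hsol' _ hxα).phase_ne_zero hp hμ hQ hxα.1.ne' (projIcc 0 m hm.le x.2).2 hx'
  obtain ⟨L₀, hL₀c, hL₀⟩ := Complex.exists_continuousOn_eqOn_exp_comp hUs hUo hzc hz0
  have hslice : ∀ r : ℝ, ContinuousOn (fun α => L₀ (α, r)) (Ioc 0 A) := fun r =>
    hL₀c.comp (by fun_prop) fun α hα => ⟨hα.1, mem_univ _⟩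
  -- At `r = 0` the phase is the positive real `α`, so the subtracted term is a multiple of `2πi`.
  -- The exponential is unchanged and the argument now starts at zero.
  set L : ℝ → ℝ → ℂ := fun α r => L₀ (α, r) - (L₀ (α, 0)).im * Complex.I with hL
  have hz' : ∀ α ∈ Ioc 0 A, ∀ r ∈ Icc 0 m, z (α, r) = phase Q (W α) (V α) r := by
    intro α hα r hr
    simp only [hz]
    rw [min_eq_left hα.2, projIcc_of_mem hm.le hr]
  have hlog : ∀ α ∈ Ioc 0 A, IsPhaseLog Q (W α) (V α) m (L α) := by
    intro α hα
    refine ⟨?_, fun r hr => ?_, by simp [hL]⟩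
    · have : Continuous fun r => L₀ (α, r) :=
        continuousOn_univ.1 (hL₀c.comp (by fun_prop) fun r _ => ⟨hα.1, mem_univ _⟩)
      exact this.sub continuous_const
    · have h1 : Complex.exp (L₀ (α, r)) = phase Q (W α) (V α) r := by
        rw [← hz' α hα r hr]; exact hL₀ ⟨hα.1, mem_univ _⟩
      have h2 : Complex.exp (L₀ (α, 0)) = (α : ℂ) := by
        have h3 : Complex.exp (L₀ (α, 0)) = phase Q (W α) (V α) 0 := by
          rw [← hz' α hα 0 (left_mem_Icc.2 hm.le)]; exact hL₀ ⟨hα.1, mem_univ _⟩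
        rw [h3]
        apply Complex.ext <;> simp [phase, (hsol' α hα).init, (hsol' α hα).init']
      have h4 : Complex.exp ((L₀ (α, 0)).im * Complex.I) = 1 := by
        have h5 : Real.exp (L₀ (α, 0)).re = α := by
          have := congrArg (‖·‖) h2
          simpa [Complex.norm_exp, abs_of_pos hα.1] using this
        have h6 : L₀ (α, 0) = ((L₀ (α, 0)).re : ℂ) + (L₀ (α, 0)).im * Complex.I :=
          (Complex.re_add_im _).symm
        have hα0 : (α : ℂ) ≠ 0 := by exact_mod_cast hα.1.ne'
        rw [h6, Complex.exp_add, ← Complex.ofReal_exp, h5] at h2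
        exact mul_left_cancel₀ hα0 (by rw [h2, mul_one])
      rw [hL]
      simp only
      rw [Complex.exp_sub, h4, div_one, h1]
  refine ⟨W, V, L, fun α hα => ⟨hsol' α hα, hlog α hα⟩, ?_, ?_, ?_⟩
  · exact (hslice m).sub ((Complex.continuous_ofReal.comp_continuousOn
      (Complex.continuous_im.comp_continuousOn (hslice 0))).mul continuousOn_const)
  · refine ⟨1 / C, by positivity, fun α hα hαδ => (hlog α hα).im_gt_of_pos hm ?_⟩
    refine (hsol' α hα).pos_of_abs_le_one hp hμ hQ hα.1 fun r hr => ?_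
    have h1 := (hlip α 0 r hr).1
    rw [(h0 r hr).1, sub_zero, sub_zero, abs_of_pos hα.1] at h1
    refine h1.trans ?_
    rwa [le_div_iff₀' hC] at hαδ
  · intro c
    have hB : 0 < C * (1 + |Q m|) := by positivity
    refine ⟨Real.exp c / (2 * (C * (1 + |Q m|))), by positivity, fun α hα hαδ => ?_⟩
    have hmI := right_mem_Icc.2 hm.le
    obtain ⟨h1, h2⟩ := hlip α 0 m hmI
    rw [(h0 m hmI).1, sub_zero, sub_zero, abs_of_pos hα.1] at h1
    rw [(h0 m hmI).2, sub_zero, sub_zero, abs_of_pos hα.1] at h2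
    have h3 : Real.exp (L α m).re ≤ C * (1 + |Q m|) * α := by
      rw [← Complex.norm_exp, (hlog α hα).exp_eq m hmI]
      refine (Complex.norm_le_abs_re_add_abs_im _).trans ?_
      simp only [phase, abs_mul]
      have := mul_le_mul_of_nonneg_left h2 (abs_nonneg (Q m))
      linarith
    rw [le_div_iff₀ (by positivity)] at hαδ
    have := Real.exp_pos c
    exact Real.exp_lt_exp.1 (by linarith)

/-- Large initial values make the phase wind arbitrarily often. -/
theorem IsWeight.exists_winding (hQ : IsWeight Q q a m) (ha : 1 ≤ a) (hp : 1 < p)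
    (hμ : 0 < μ) (hpa : ((a : ℝ) - 1) * p < a + 3) (c : ℝ) :
    ∃ α > 0, ∀ (w v : ℝ → ℝ) (L : ℝ → ℂ), ShootSol q m (nonlin p μ) α w v →
      IsPhaseLog Q w v m L → (L m).im < c := by
  obtain ⟨T, hT, hz⟩ := hQ.exists_zero_of_large ha hp hμ hpa
  obtain ⟨n, hn⟩ := exists_nat_gt (-c / Real.pi)
  -- The intervals `[(2i + 1) d, (2i + 2) d]` for `i ≤ n` are disjoint, avoid the origin and lie in
  -- `(0, T]`, so they yield `n + 1` ordered zeros.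
  set d := T / (2 * n + 2) with hd
  have hd0 : 0 < d := by have := hT.1; positivity
  have hdT : d * (2 * n + 2) = T := by rw [hd]; field_simp
  have hev : ∀ᶠ α in atTop, ∀ i ∈ Finset.range (n + 1), ∀ w v : ℝ → ℝ,
      ShootSol q m (nonlin p μ) α w v →
        ∃ r ∈ Icc ((2 * i + 1) * d) ((2 * i + 2) * d), w r = 0 := by
    rw [Finset.eventually_all]
    intro i hi
    have hi' : (i : ℝ) ≤ n := by exact_mod_cast Nat.lt_succ_iff.1 (Finset.mem_range.1 hi)
    refine hz _ _ (by positivity) (by nlinarith) ?_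
    rw [← hdT]
    nlinarith
  obtain ⟨α, hα, hα0⟩ := (hev.and (eventually_gt_atTop 0)).exists
  refine ⟨α, hα0, fun w v L h hL => ?_⟩
  have hex : ∀ i : ℕ, ∃ r, i ≤ n → r ∈ Icc ((2 * i + 1) * d) ((2 * i + 2) * d) ∧ w r = 0 := by
    intro i
    by_cases hi : i ≤ n
    · obtain ⟨r, hr, hr'⟩ := hα i (Finset.mem_range.2 (by omega)) w v h
      exact ⟨r, fun _ => ⟨hr, hr'⟩⟩
    · exact ⟨0, fun h => absurd h hi⟩
  choose x hx using hex
  have hxm : ∀ i ≤ n, x i ∈ Ioo 0 m := by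
    intro i hi
    have hi' : (i : ℝ) ≤ n := by exact_mod_cast hi
    refine ⟨lt_of_lt_of_le (by positivity) (hx i hi).1.1, ((hx i hi).1.2.trans ?_).trans_lt hT.2⟩
    rw [← hdT]
    nlinarith
  have hmono : ∀ i < n, x i < x (i + 1) := by
    intro i hi
    refine (hx i hi.le).1.2.trans_lt (lt_of_lt_of_le ?_ (hx (i + 1) hi).1.1)
    push_cast
    nlinarith
  have h1 := hL.im_le_of_zeros hQ h hxm hmono (fun i hi => (hx i hi).2) n le_rfl
  have h2 := hL.barrier hQ h (-1 - n) (hxm n le_rfl).1 (hxm n le_rfl).2.le le_rfl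
    (by push_cast; linarith)
  rw [div_lt_iff₀ Real.pi_pos] at hn
  push_cast at h2
  nlinarith [Real.pi_pos]

/-! ### A planar root criterion by winding along a rectangle. -/

theorem stays_of_avoids {f : ℝ → ℝ} {c d lo hi x y : ℝ} (hf : ContinuousOn f (Icc c d))
    (havoid : ∀ t ∈ Icc c d, f t ≠ lo ∧ f t ≠ hi) (hx : x ∈ Icc c d) (hy : y ∈ Icc c d)
    (hfx : f x ∈ Ioo lo hi) : f y ∈ Ioo lo hi := by
  have hord : (f '' Icc c d).OrdConnected :=
    (isPreconnected_Icc.image f hf).ordConnected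
  constructor
  · by_contra! hle
    obtain ⟨t, ht, ht'⟩ := hord.out (mem_image_of_mem f hy) (mem_image_of_mem f hx) ⟨hle, hfx.1.le⟩
    exact (havoid t ht).1 ht'
  · by_contra! hle
    obtain ⟨t, ht, ht'⟩ := hord.out (mem_image_of_mem f hx) (mem_image_of_mem f hy) ⟨hfx.2.le, hle⟩
    exact (havoid t ht).2 ht'

/-- A continuous map of a rectangle to the plane which winds once around the origin along the
boundary, in the sense of the given sign conditions, has a zero. -/
theorem exists_zero_of_boundary_signs {F : ℝ → ℝ → ℂ} {a₀ a₁ b₀ b₁ : ℝ} (ha : a₀ ≤ a₁)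
    (hb : b₀ ≤ b₁) (hF : ContinuousOn (fun x : ℝ × ℝ => F x.1 x.2) (Icc a₀ a₁ ×ˢ Icc b₀ b₁))
    (hright : ∀ y ∈ Icc b₀ b₁, (F a₁ y).re < 0) (htop : ∀ x ∈ Icc a₀ a₁, (F x b₁).re < 0)
    (hleft : ∀ y ∈ Icc b₀ b₁, 0 < (F a₀ y).re ∨ (F a₀ y).im < 0)
    (hbot : ∀ x ∈ Icc a₀ a₁, 0 < (F x b₀).re ∨ 0 < (F x b₀).im)
    (hcorner : 0 < (F a₀ b₀).re) :
    ∃ x ∈ Icc a₀ a₁, ∃ y ∈ Icc b₀ b₁, F x y = 0 := by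
  by_contra! hne
  have hpi := Real.pi_pos
  set z : ℝ × ℝ → ℂ := fun x => F (projIcc a₀ a₁ ha x.1) (projIcc b₀ b₁ hb x.2) with hz
  have hzc : Continuous z := by
    refine continuousOn_univ.1 (hF.comp (f := fun x : ℝ × ℝ =>
      ((projIcc a₀ a₁ ha x.1 : ℝ), (projIcc b₀ b₁ hb x.2 : ℝ))) (by fun_prop) ?_)
    exact fun x _ => ⟨(projIcc a₀ a₁ ha x.1).2, (projIcc b₀ b₁ hb x.2).2⟩
  obtain ⟨G, hGc, hG⟩ := Complex.exists_continuousOn_eqOn_exp_comp (U := univ)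
    (isSimplyConnected_of_convex convex_univ univ_nonempty) isOpen_univ hzc.continuousOn
    (by rintro ⟨x, -, hx⟩
        exact hne _ (projIcc a₀ a₁ ha x.1).2 _ (projIcc b₀ b₁ hb x.2).2 hx)
  rw [continuousOn_univ] at hGc
  have hexp : ∀ x ∈ Icc a₀ a₁, ∀ y ∈ Icc b₀ b₁, Complex.exp (G (x, y)) = F x y := by
    intro x hx y hy
    have : Complex.exp (G (x, y)) = z (x, y) := hG (mem_univ _)
    rw [this, hz]
    simp only
    rw [projIcc_of_mem ha hx, projIcc_of_mem hb hy]
  have hre : ∀ x ∈ Icc a₀ a₁, ∀ y ∈ Icc b₀ b₁,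
      (F x y).re = Real.exp (G (x, y)).re * Real.cos (G (x, y)).im := fun x hx y hy => by
    rw [← hexp x hx y hy, Complex.exp_re]
  have him : ∀ x ∈ Icc a₀ a₁, ∀ y ∈ Icc b₀ b₁,
      (F x y).im = Real.exp (G (x, y)).re * Real.sin (G (x, y)).im := fun x hx y hy => by
    rw [← hexp x hx y hy, Complex.exp_im]
  have ha₀ := left_mem_Icc.2 ha
  have ha₁ := right_mem_Icc.2 ha
  have hb₀ := left_mem_Icc.2 hb
  have hb₁ := right_mem_Icc.2 hb
  -- normalise the branch at the corner
  obtain ⟨k, hk⟩ : ∃ k : ℤ, (G (a₀, b₀)).im - k * (2 * Real.pi) ∈ Ioo (-Real.pi / 2) (Real.pi / 2) := by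
    set t := (G (a₀, b₀)).im
    have h1 : 0 < Real.cos t := by
      have := hre a₀ ha₀ b₀ hb₀
      rw [this] at hcorner
      exact pos_of_mul_pos_right hcorner (Real.exp_pos _).le
    refine ⟨round (t / (2 * Real.pi)), ?_⟩
    have h2 := abs_sub_round (t / (2 * Real.pi))
    set k := round (t / (2 * Real.pi))
    have h3 : t - k * (2 * Real.pi) = (t / (2 * Real.pi) - k) * (2 * Real.pi) := by field_simp
    rw [abs_le] at h2
    have h4 : 0 < Real.cos (t - k * (2 * Real.pi)) := by rwa [Real.cos_sub_int_mul_two_pi]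
    constructor
    · by_contra! hle
      have := Real.cos_nonpos_of_pi_div_two_le_of_le (x := -(t - k * (2 * Real.pi)))
        (by linarith) (by nlinarith)
      rw [Real.cos_neg] at this
      linarith
    · by_contra! hle
      have := Real.cos_nonpos_of_pi_div_two_le_of_le hle (by nlinarith)
      linarith
  set φ : ℝ → ℝ → ℝ := fun x y => (G (x, y)).im - k * (2 * Real.pi) with hφ
  have hφx : ∀ y, Continuous fun x => φ x y := fun y =>
    (Complex.continuous_im.comp (hGc.comp (by fun_prop))).sub continuous_const
  have hφy : ∀ x, Continuous fun y => φ x y := fun x =>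
    (Complex.continuous_im.comp (hGc.comp (by fun_prop))).sub continuous_const
  have hcos : ∀ x ∈ Icc a₀ a₁, ∀ y ∈ Icc b₀ b₁, ∃ ρ > 0,
      (F x y).re = ρ * Real.cos (φ x y) ∧ (F x y).im = ρ * Real.sin (φ x y) := by
    intro x hx y hy
    refine ⟨Real.exp (G (x, y)).re, Real.exp_pos _, ?_, ?_⟩
    · rw [hre x hx y hy, hφ, Real.cos_sub_int_mul_two_pi]
    · rw [him x hx y hy, hφ, Real.sin_sub_int_mul_two_pi]
  have hsin32 : Real.cos (3 * Real.pi / 2) = 0 := by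
    rw [show 3 * Real.pi / 2 = Real.pi / 2 + Real.pi by ring, Real.cos_add_pi, Real.cos_pi_div_two,
      neg_zero]
  have e1 : -Real.pi / 2 = -(Real.pi / 2) := by ring
  -- The left edge misses the closed quadrant `re ≤ 0 ≤ im`, which confines the argument from the
  -- corner on. The bottom edge likewise misses `re, im ≤ 0`, and its end is then forced into the
  -- left half plane near argument `π`.
  have left_edge := stays_of_avoids (lo := -Real.pi) (hi := Real.pi / 2) (hφy a₀).continuousOn
    (fun t ht => by
      obtain ⟨ρ, hρ, h1, h2⟩ := hcos a₀ ha₀ t ht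
      have h3 := hleft t ht
      constructor <;> intro h <;> rw [h1, h2, h] at h3
      · simp only [Real.cos_neg, Real.cos_pi, Real.sin_neg, Real.sin_pi] at h3
        rcases h3 with h3 | h3 <;> linarith
      · simp only [Real.cos_pi_div_two, Real.sin_pi_div_two] at h3
        rcases h3 with h3 | h3 <;> linarith)
    hb₀ hb₁ ⟨by linarith [hk.1], hk.2⟩
  have bottom_edge := stays_of_avoids (lo := -Real.pi / 2) (hi := Real.pi) (hφx b₀).continuousOn
    (fun t ht => by
      obtain ⟨ρ, hρ, h1, h2⟩ := hcos t ht b₀ hb₀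
      have h3 := hbot t ht
      constructor <;> intro h <;> rw [h1, h2, h] at h3
      · simp only [e1, Real.cos_neg, Real.sin_neg, Real.cos_pi_div_two, Real.sin_pi_div_two] at h3
        rcases h3 with h3 | h3 <;> linarith
      · simp only [Real.cos_pi, Real.sin_pi] at h3
        rcases h3 with h3 | h3 <;> linarith)
    ha₀ ha₁ ⟨hk.1, by linarith [hk.2]⟩
  have start : φ a₁ b₀ ∈ Ioo (Real.pi / 2) (3 * Real.pi / 2) := by
    refine ⟨?_, by linarith [bottom_edge.2]⟩
    by_contra! hle
    obtain ⟨ρ, hρ, h1, h2⟩ := hcos a₁ ha₁ b₀ hb₀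
    have h3 := hright b₀ hb₀
    rw [h1] at h3
    have h4 := Real.cos_nonneg_of_neg_pi_div_two_le_of_le (x := φ a₁ b₀)
      (by linarith [bottom_edge.1]) hle
    nlinarith
  have right_edge := stays_of_avoids (hφy a₁).continuousOn
    (fun t ht => by
      obtain ⟨ρ, hρ, h1, h2⟩ := hcos a₁ ha₁ t ht
      have h3 := hright t ht
      constructor <;> intro h <;> rw [h1, h] at h3
      · simp [Real.cos_pi_div_two] at h3
      · simp [hsin32] at h3)
    hb₀ hb₁ start
  have top_edge := stays_of_avoids (hφx b₁).continuousOn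
    (fun t ht => by
      obtain ⟨ρ, hρ, h1, h2⟩ := hcos t ht b₁ hb₁
      have h3 := htop t ht
      constructor <;> intro h <;> rw [h1, h] at h3
      · simp [Real.cos_pi_div_two] at h3
      · simp [hsin32] at h3)
    ha₁ ha₀ right_edge
  -- The two routes to the corner `(a₀, b₁)` disagree: the argument is below `π / 2` along the left
  -- edge and above it along the other three.
  exact absurd left_edge.2 (not_lt.2 top_edge.1.le)

end NodalYamabe

/-! ### Matching two shooting problems. -/

namespace NodalYamabe

variable {Q q w v : ℝ → ℝ} {a : ℕ} {m p μ α : ℝ}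

/-- Two singular problems with matching weights have solutions whose phases at the matching point
are complex conjugate, one of which winds at least `K` half turns. -/
theorem exists_matching {Q₁ q₁ Q₂ q₂ : ℝ → ℝ} {a b : ℕ} {m₁ m₂ : ℝ}
    (h₁ : IsWeight Q₁ q₁ a m₁) (h₂ : IsWeight Q₂ q₂ b m₂) (hQ : Q₁ m₁ = Q₂ m₂) (ha : 1 ≤ a)
    (hb : 1 ≤ b) (hp : 1 < p) (hμ : 0 < μ) (hpa : ((a : ℝ) - 1) * p < a + 3)
    (hpb : ((b : ℝ) - 1) * p < b + 3) {K : ℕ} (hK : 1 ≤ K) :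
    ∃ (α β : ℝ) (w₁ v₁ w₂ v₂ : ℝ → ℝ), 0 < α ∧ 0 < β ∧
      ShootSol q₁ m₁ (nonlin p μ) α w₁ v₁ ∧ ShootSol q₂ m₂ (nonlin p μ) β w₂ v₂ ∧
      w₁ m₁ = w₂ m₂ ∧ v₁ m₁ = -v₂ m₂ ∧
      ((∃ Z : Finset ℝ, Z.card = K ∧ ∀ r ∈ Z, r ∈ Ioo 0 m₁ ∧ w₁ r = 0) ∧
          (∃ r ∈ Icc 0 m₁, w₁ r < 0) ∨
        (∃ Z : Finset ℝ, Z.card = K ∧ ∀ r ∈ Z, r ∈ Ioo 0 m₂ ∧ w₂ r = 0) ∧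
          (∃ r ∈ Icc 0 m₂, w₂ r < 0)) := by
  have hpi := Real.pi_pos
  have hK' : (1 : ℝ) ≤ K := by exact_mod_cast hK
  -- The other argument never exceeds `π / 2`, so winding below `-π / 2 - 2πK` makes the real part
  -- of `F` negative on this whole edge.
  obtain ⟨A, hA, hwA⟩ := h₁.exists_winding ha hp hμ hpa (-Real.pi / 2 - 2 * Real.pi * K)
  obtain ⟨B, hB, hwB⟩ := h₂.exists_winding hb hp hμ hpb (-Real.pi / 2 - 2 * Real.pi * K)
  obtain ⟨W₁, V₁, L₁, hsol₁, hc₁, ⟨δ₁, hδ₁, him₁⟩, hre₁⟩ := h₁.exists_phaseLog_family hp hμ hA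
  obtain ⟨W₂, V₂, L₂, hsol₂, hc₂, ⟨δ₂, hδ₂, him₂⟩, hre₂⟩ := h₂.exists_phaseLog_family hp hμ hB
  obtain ⟨c₁, hc₁'⟩ := (isCompact_Icc (a := δ₁) (b := A)).exists_bound_of_continuousOn
    (Complex.continuous_re.comp_continuousOn (hc₁.mono fun x hx => ⟨hδ₁.trans_le hx.1, hx.2⟩))
  obtain ⟨c₂, hc₂'⟩ := (isCompact_Icc (a := δ₂) (b := B)).exists_bound_of_continuousOn
    (Complex.continuous_re.comp_continuousOn (hc₂.mono fun x hx => ⟨hδ₂.trans_le hx.1, hx.2⟩))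
  obtain ⟨η₁, hη₁, hre₁'⟩ := hre₁ (-c₂)
  obtain ⟨η₂, hη₂, hre₂'⟩ := hre₂ (-c₁)
  -- `δ₁` keeps the argument above `-π / 2`. `η₁` puts the modulus below that of every second
  -- solution with initial value in `[δ₂, B]`; the remaining `y ≤ δ₂` are handled by the arguments.
  set α₀ := min (min δ₁ η₁) A
  set β₀ := min (min δ₂ η₂) B
  have hα₀ : 0 < α₀ := lt_min (lt_min hδ₁ hη₁) hA
  have hβ₀ : 0 < β₀ := lt_min (lt_min hδ₂ hη₂) hB
  have hα₀A : α₀ ≤ A := min_le_right _ _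
  have hβ₀B : β₀ ≤ B := min_le_right _ _
  have hα₀δ : α₀ ≤ δ₁ := (min_le_left _ _).trans (min_le_left _ _)
  have hβ₀δ : β₀ ≤ δ₂ := (min_le_left _ _).trans (min_le_left _ _)
  have hα₀η : α₀ ≤ η₁ := (min_le_left _ _).trans (min_le_right _ _)
  have hβ₀η : β₀ ≤ η₂ := (min_le_left _ _).trans (min_le_right _ _)
  have hsub₁ : ∀ x ∈ Icc α₀ A, x ∈ Ioc 0 A := fun x hx => ⟨hα₀.trans_le hx.1, hx.2⟩
  have hsub₂ : ∀ x ∈ Icc β₀ B, x ∈ Ioc 0 B := fun x hx => ⟨hβ₀.trans_le hx.1, hx.2⟩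
  -- A zero of `F` says `L₁ = conj L₂ - 2πiK`. The conjugate reflects the sign change of the
  -- derivative when the second half is traversed backwards.
  set F : ℝ → ℝ → ℂ := fun x y =>
    ⟨(L₁ x m₁).im + (L₂ y m₂).im + 2 * Real.pi * K, (L₁ x m₁).re - (L₂ y m₂).re⟩ with hF
  have hFc : ContinuousOn (fun x : ℝ × ℝ => F x.1 x.2) (Icc α₀ A ×ˢ Icc β₀ B) := by
    have k₁ : ContinuousOn (fun x : ℝ × ℝ => L₁ x.1 m₁) (Icc α₀ A ×ˢ Icc β₀ B) :=
      (hc₁.mono hsub₁).comp continuousOn_fst fun x hx => hx.1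
    have k₂ : ContinuousOn (fun x : ℝ × ℝ => L₂ x.2 m₂) (Icc α₀ A ×ˢ Icc β₀ B) :=
      (hc₂.mono hsub₂).comp continuousOn_snd fun x hx => hx.2
    have i₁ := Complex.continuous_im.comp_continuousOn k₁
    have i₂ := Complex.continuous_im.comp_continuousOn k₂
    have r₁ := Complex.continuous_re.comp_continuousOn k₁
    have r₂ := Complex.continuous_re.comp_continuousOn k₂
    have := (Complex.continuous_ofReal.comp_continuousOn
      ((i₁.add i₂).add (continuousOn_const (c := 2 * Real.pi * K)))).add
      ((Complex.continuous_ofReal.comp_continuousOn (r₁.sub r₂)).mul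
        (continuousOn_const (c := Complex.I)))
    refine this.congr fun x _ => ?_
    apply Complex.ext <;> simp [hF]
  have hend₁ : ∀ x ∈ Icc α₀ A, (L₁ x m₁).im ≤ Real.pi / 2 := fun x hx =>
    (hsol₁ x (hsub₁ x hx)).2.im_end_le h₁ (hsol₁ x (hsub₁ x hx)).1
  have hend₂ : ∀ x ∈ Icc β₀ B, (L₂ x m₂).im ≤ Real.pi / 2 := fun x hx =>
    (hsol₂ x (hsub₂ x hx)).2.im_end_le h₂ (hsol₂ x (hsub₂ x hx)).1
  have hα₀' := him₁ α₀ ⟨hα₀, hα₀A⟩ hα₀δ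
  have hβ₀' := him₂ β₀ ⟨hβ₀, hβ₀B⟩ hβ₀δ
  have hwind : 2 * Real.pi ≤ 2 * Real.pi * K := by nlinarith
  obtain ⟨x, hx, y, hy, hxy⟩ := exists_zero_of_boundary_signs hα₀A hβ₀B hFc
    (by
      intro y hy
      have h1 := hwA _ _ _ (hsol₁ A ⟨hA, le_rfl⟩).1 (hsol₁ A ⟨hA, le_rfl⟩).2
      have h2 := hend₂ y hy
      simp only [hF]
      linarith)
    (by
      intro x hx
      have h1 := hwB _ _ _ (hsol₂ B ⟨hB, le_rfl⟩).1 (hsol₂ B ⟨hB, le_rfl⟩).2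
      have h2 := hend₁ x hx
      simp only [hF]
      linarith)
    (by
      intro y hy
      rcases le_total y δ₂ with h | h
      · left
        have := him₂ y (hsub₂ y hy) h
        simp only [hF]
        linarith
      · right
        have h1 := (abs_le.1 (hc₂' y ⟨h, hy.2⟩)).1
        have h2 := hre₁' α₀ ⟨hα₀, hα₀A⟩ hα₀η
        simp only [Function.comp] at h1
        simp only [hF]
        linarith)
    (by
      intro x hx
      rcases le_total x δ₁ with h | h
      · left
        have := him₁ x (hsub₁ x hx) h
        simp only [hF]
        linarith
      · right
        have h1 := (abs_le.1 (hc₁' x ⟨h, hx.2⟩)).1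
        have h2 := hre₂' β₀ ⟨hβ₀, hβ₀B⟩ hβ₀η
        simp only [Function.comp] at h1
        simp only [hF]
        linarith)
    (by
      simp only [hF]
      linarith)
  have hθ : (L₁ x m₁).im + (L₂ y m₂).im + 2 * Real.pi * K = 0 := congrArg Complex.re hxy
  have hρ : (L₁ x m₁).re - (L₂ y m₂).re = 0 := congrArg Complex.im hxy
  obtain ⟨s₁, l₁⟩ := hsol₁ x (hsub₁ x hx)
  obtain ⟨s₂, l₂⟩ := hsol₂ y (hsub₂ y hy)
  have hm₁ := right_mem_Icc.2 h₁.pos_length.le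
  have hm₂ := right_mem_Icc.2 h₂.pos_length.le
  have eθ : (L₁ x m₁).im = -((L₂ y m₂).im + K * (2 * Real.pi)) := by linarith
  refine ⟨x, y, W₁ x, V₁ x, W₂ y, V₂ y, (hsub₁ x hx).1, (hsub₂ y hy).1, s₁, s₂, ?_, ?_, ?_⟩
  · rw [l₁.eq_cos hm₁, l₂.eq_cos hm₂, eθ, Real.cos_neg, Real.cos_add_nat_mul_two_pi,
      sub_eq_zero.1 hρ]
  · have hQm := h₂.pos m₂ ⟨h₂.pos_length, le_rfl⟩
    have e₁ := l₁.eq_sin hm₁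
    have e₂ := l₂.eq_sin hm₂
    rw [eθ, Real.sin_neg, Real.sin_add_nat_mul_two_pi, sub_eq_zero.1 hρ, hQ] at e₁
    refine mul_left_cancel₀ hQm.ne' ?_
    rw [e₁, mul_neg, mul_neg, e₂]
  · have hKpi : Real.pi ≤ K * Real.pi := by nlinarith
    -- The arguments sum to `-2πK`, so at least one of them is at most `-πK`.
    rcases le_total (L₁ x m₁).im (-(K * Real.pi)) with h | h
    · exact Or.inl ⟨l₁.exists_zeros h₁.pos_length h, l₁.exists_neg h₁.pos_length (by linarith)⟩
    · have h' : (L₂ y m₂).im ≤ -(K * Real.pi) := by linarith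
      exact Or.inr ⟨l₂.exists_zeros h₂.pos_length h', l₂.exists_neg h₂.pos_length (by linarith)⟩

/-! ### The concrete density and its mean curvature. -/

/-- The volume density of the isoparametric foliation, up to a constant. -/
noncomputable def density (a b : ℕ) (r : ℝ) : ℝ := Real.sin (r / 2) ^ a * Real.cos (r / 2) ^ b

/-- The mean curvature of the isoparametric hypersurfaces, with principal curvatures paired. -/
noncomputable def meanCurv (a b : ℕ) (r : ℝ) : ℝ :=
  a / 2 * (Real.cos (r / 2) / Real.sin (r / 2)) - b / 2 * (Real.sin (r / 2) / Real.cos (r / 2))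

/-- The zero of `meanCurv a b` in `(0, π)`. -/
noncomputable def minimalAngle (a b : ℕ) : ℝ := 2 * Real.arctan (√(a / b))

section Density

variable {b : ℕ}

theorem sin_half_pos {r : ℝ} (hr : r ∈ Ioo 0 Real.pi) : 0 < Real.sin (r / 2) :=
  Real.sin_pos_of_pos_of_lt_pi (by linarith [hr.1]) (by linarith [hr.1, hr.2])

theorem cos_half_pos {r : ℝ} (hr : r ∈ Ioo 0 Real.pi) : 0 < Real.cos (r / 2) :=
  Real.cos_pos_of_mem_Ioo ⟨by linarith [hr.1, Real.pi_pos], by linarith [hr.2]⟩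

theorem minimalAngle_mem (ha : 1 ≤ a) (hb : 1 ≤ b) : minimalAngle a b ∈ Ioo 0 Real.pi := by
  have ha' : (1 : ℝ) ≤ a := by exact_mod_cast ha
  have hb' : (1 : ℝ) ≤ b := by exact_mod_cast hb
  have h1 : 0 < √((a : ℝ) / b) := Real.sqrt_pos.2 (by positivity)
  have h2 := Real.arctan_pos.2 h1
  have h3 := Real.arctan_lt_pi_div_two (√((a : ℝ) / b))
  exact ⟨by rw [minimalAngle]; linarith, by rw [minimalAngle]; linarith⟩

/-- The reflection `r ↦ π - r` swaps the multiplicities and inverts the tangent of the half angle,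
so both shooting problems end at the same hypersurface. -/
theorem minimalAngle_add (ha : 1 ≤ a) (hb : 1 ≤ b) :
    minimalAngle b a = Real.pi - minimalAngle a b := by
  have ha' : (1 : ℝ) ≤ a := by exact_mod_cast ha
  have hb' : (1 : ℝ) ≤ b := by exact_mod_cast hb
  have h1 : 0 < √((a : ℝ) / b) := Real.sqrt_pos.2 (by positivity)
  have h2 := Real.arctan_inv_of_pos h1
  rw [← Real.sqrt_inv, inv_div] at h2
  rw [minimalAngle, minimalAngle, h2]
  ring

theorem density_reflect (r : ℝ) : density b a (Real.pi - r) = density a b r := by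
  rw [density, density, sub_div, Real.sin_pi_div_two_sub, Real.cos_pi_div_two_sub, mul_comm]

theorem meanCurv_reflect (r : ℝ) : meanCurv b a (Real.pi - r) = -meanCurv a b r := by
  rw [meanCurv, meanCurv, sub_div, Real.sin_pi_div_two_sub, Real.cos_pi_div_two_sub]
  ring

theorem density_pos {r : ℝ} (hr : r ∈ Ioo 0 Real.pi) : 0 < density a b r :=
  mul_pos (pow_pos (sin_half_pos hr) _) (pow_pos (cos_half_pos hr) _)

theorem continuousOn_meanCurv : ContinuousOn (meanCurv a b) (Ioo 0 Real.pi) := by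
  have h1 : ∀ r ∈ Ioo 0 Real.pi, Real.sin (r / 2) ≠ 0 := fun r hr => (sin_half_pos hr).ne'
  have h2 : ∀ r ∈ Ioo 0 Real.pi, Real.cos (r / 2) ≠ 0 := fun r hr => (cos_half_pos hr).ne'
  unfold meanCurv
  fun_prop (disch := assumption)

theorem hasDerivAt_density (ha : 1 ≤ a) (hb : 1 ≤ b) {r : ℝ} (hr : r ∈ Ioo 0 Real.pi) :
    HasDerivAt (density a b) (meanCurv a b r * density a b r) r := by
  have hs := sin_half_pos hr
  have hc := cos_half_pos hr
  have h := (((hasDerivAt_id r).div_const 2).sin.pow a).mul (((hasDerivAt_id r).div_const 2).cos.pow b)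
  refine h.congr_deriv ?_
  obtain ⟨a, rfl⟩ := Nat.exists_eq_add_of_le' ha
  obtain ⟨b, rfl⟩ := Nat.exists_eq_add_of_le' hb
  simp only [id, meanCurv, density, Nat.add_sub_cancel, Pi.pow_apply]
  push_cast
  field_simp
  ring

/-- The sign is that of `a cos² (r / 2) - b sin² (r / 2)`, which is nonnegative exactly while `tan²
(r / 2) ≤ a / b`. -/
theorem meanCurv_nonneg (ha : 1 ≤ a) (hb : 1 ≤ b) {r : ℝ} (hr : r ∈ Ioc 0 (minimalAngle a b)) :
    0 ≤ meanCurv a b r := by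
  have hrp : r ∈ Ioo 0 Real.pi := ⟨hr.1, hr.2.trans_lt (minimalAngle_mem ha hb).2⟩
  have hs := sin_half_pos hrp
  have hc := cos_half_pos hrp
  have hb' : (0 : ℝ) < b := by exact_mod_cast hb
  have h1 : Real.tan (r / 2) ≤ √((a : ℝ) / b) := by
    have h2 : r / 2 ≤ Real.arctan (√((a : ℝ) / b)) := by
      have := hr.2
      rw [minimalAngle] at this
      linarith
    rw [← Real.tan_arctan (√((a : ℝ) / b))]
    exact Real.strictMonoOn_tan.monotoneOn ⟨by linarith [hrp.1, Real.pi_pos], by linarith [hrp.2]⟩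
      ⟨Real.neg_pi_div_two_lt_arctan _, Real.arctan_lt_pi_div_two _⟩ h2
  have h0 : 0 ≤ Real.tan (r / 2) := by rw [Real.tan_eq_sin_div_cos]; positivity
  have h3 : Real.tan (r / 2) ^ 2 ≤ a / b := by
    calc _ ≤ √((a : ℝ) / b) ^ 2 := pow_le_pow_left₀ h0 h1 2
      _ = _ := Real.sq_sqrt (by positivity)
  rw [Real.tan_eq_sin_div_cos, div_pow, div_le_div_iff₀ (by positivity) hb'] at h3
  have e : meanCurv a b r = (a * Real.cos (r / 2) ^ 2 - Real.sin (r / 2) ^ 2 * b) /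
      (2 * Real.sin (r / 2) * Real.cos (r / 2)) := by
    rw [meanCurv]; field_simp
  rw [e]
  exact div_nonneg (by linarith) (by positivity)

theorem tendsto_mul_meanCurv :
    Tendsto (fun r => r * meanCurv a b r) (𝓝[>] 0) (𝓝 a) := by
  have h1 : Tendsto (fun r : ℝ => Real.sin (r / 2) / r) (𝓝[>] 0) (𝓝 (1 / 2)) := by
    have h := ((hasDerivAt_id (0 : ℝ)).div_const 2).sin.tendsto_slope_zero_right
    simp at h
    simpa [div_eq_inv_mul] using h
  have h2 : Tendsto (fun r : ℝ => Real.cos (r / 2)) (𝓝[>] 0) (𝓝 1) := by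
    have : Continuous fun r : ℝ => Real.cos (r / 2) := by fun_prop
    have h := this.tendsto 0
    simp only [zero_div, Real.cos_zero] at h
    exact h.mono_left nhdsWithin_le_nhds
  have h3 : Tendsto (fun r : ℝ => r * Real.sin (r / 2)) (𝓝[>] 0) (𝓝 0) := by
    have : Continuous fun r : ℝ => r * Real.sin (r / 2) := by fun_prop
    have h := this.tendsto 0
    simp only [zero_mul] at h
    exact h.mono_left nhdsWithin_le_nhds
  have h4 := ((h2.div h1 (by norm_num)).const_mul ((a : ℝ) / 2)).sub
    ((h3.div h2 one_ne_zero).const_mul ((b : ℝ) / 2))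
  have e : (a : ℝ) / 2 * (1 / (1 / 2)) - b / 2 * (0 / 1) = a := by ring
  rw [e] at h4
  refine h4.congr' ?_
  filter_upwards [self_mem_nhdsWithin] with r hr
  have hr' : r ≠ 0 := ne_of_gt hr
  rw [meanCurv]
  simp only [Pi.div_apply, div_div_eq_mul_div]
  ring

theorem isWeight_density (ha : 1 ≤ a) (hb : 1 ≤ b) :
    IsWeight (density a b) (meanCurv a b) a (minimalAngle a b) := by
  have hm := minimalAngle_mem ha hb
  have hsub : ∀ r ∈ Ioc 0 (minimalAngle a b), r ∈ Ioo 0 Real.pi := fun r hr =>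
    ⟨hr.1, hr.2.trans_lt hm.2⟩
  have hcont : Continuous (density a b) := by unfold density; fun_prop
  have hd : ∀ r ∈ Ioo 0 (minimalAngle a b),
      HasDerivAt (density a b) (meanCurv a b r * density a b r) r := fun r hr =>
    hasDerivAt_density ha hb (hsub r ⟨hr.1, hr.2.le⟩)
  refine ⟨hm.1, hcont, ?_, fun r hr => density_pos (hsub r hr), ?_, hd,
    continuousOn_meanCurv.mono hsub, fun r hr => meanCurv_nonneg ha hb ⟨hr.1, hr.2.le⟩,
    tendsto_mul_meanCurv, ?_⟩
  · simp [density, show a ≠ 0 by omega]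
  · refine monotoneOn_of_deriv_nonneg (convex_Icc _ _) hcont.continuousOn ?_ ?_ <;>
      rw [interior_Icc]
    · exact fun r hr => (hd r hr).differentiableAt.differentiableWithinAt
    · intro r hr
      rw [(hd r hr).deriv]
      exact mul_nonneg (meanCurv_nonneg ha hb ⟨hr.1, hr.2.le⟩)
        (density_pos (hsub r ⟨hr.1, hr.2.le⟩)).le
  · refine ⟨(1 / Real.pi) ^ a * Real.cos (minimalAngle a b / 2) ^ b,
      mul_pos (by have := Real.pi_pos; positivity) (pow_pos (cos_half_pos hm) _), fun r hr => ?_⟩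
    have h1 : r / Real.pi ≤ Real.sin (r / 2) := by
      have := Real.mul_le_sin (x := r / 2) (by linarith [hr.1]) (by linarith [hr.2, hm.2])
      refine le_trans (le_of_eq ?_) this
      field_simp
    have h2 : Real.cos (minimalAngle a b / 2) ≤ Real.cos (r / 2) :=
      Real.cos_le_cos_of_nonneg_of_le_pi (by linarith [hr.1]) (by linarith [hm.1, hm.2])
        (by linarith [hr.2])
    have h3 : 0 ≤ r / Real.pi := div_nonneg hr.1 Real.pi_pos.le
    rw [density]
    calc (1 / Real.pi) ^ a * Real.cos (minimalAngle a b / 2) ^ b * r ^ a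
        = (r / Real.pi) ^ a * Real.cos (minimalAngle a b / 2) ^ b := by
          rw [div_pow, div_pow]; ring
      _ ≤ _ := mul_le_mul (pow_le_pow_left₀ h3 h1 a)
          (pow_le_pow_left₀ (cos_half_pos hm).le h2 b) (pow_nonneg (cos_half_pos hm).le _)
          (pow_nonneg (h3.trans h1) _)

end Density

end NodalYamabe

/-! ### Gluing and regularity up to the poles. -/

namespace NodalYamabe

variable {Q q w v : ℝ → ℝ} {a b : ℕ} {m p μ α : ℝ}

theorem ShootSol.flux_eq {T : ℝ} {g : ℝ → ℝ} (hg : Continuous g) (hQ : IsWeight Q q a m)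
    (hT : T ≤ m) (h : ShootSol q T g α w v) {r : ℝ} (hr : r ∈ Icc 0 T) :
    Q r * v r = -∫ s in (0 : ℝ)..r, Q s * g (w s) := by
  have hc : Continuous fun s => -(Q s * g (w s)) := (hQ.cont.mul (hg.comp h.cont)).neg
  have := intervalIntegral.integral_eq_sub_of_hasDerivAt_of_le hr.1
    (hQ.cont.mul h.cont').continuousOn
    (fun s hs => h.hasDerivAt_flux hQ hT ⟨hs.1, hs.2.trans_le hr.2⟩) (hc.intervalIntegrable _ _)
  rw [intervalIntegral.integral_neg] at this
  rw [this]
  simp [hQ.zero]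

/-- The second derivative of a solution has a limit at the singular end point. -/
theorem ShootSol.tendsto_deriv {g : ℝ → ℝ} (hg : Continuous g) (hQ : IsWeight Q q a m)
    (h : ShootSol q m g α w v) :
    Tendsto (fun r => -(q r * v r) - g (w r)) (𝓝[>] 0)
      (𝓝 (a * (g α / (a + 1)) - g α)) := by
  have h1 := (hQ.tendsto.mul (hQ.tendsto_average (hg.comp h.cont))).sub
    (((hg.comp h.cont).tendsto 0).mono_left nhdsWithin_le_nhds)
  simp only [Function.comp, h.init] at h1
  refine h1.congr' ?_
  filter_upwards [Ioo_mem_nhdsGT hQ.pos_length] with r hr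
  have h2 := h.flux_eq hg hQ le_rfl ⟨hr.1.le, hr.2.le⟩
  have h3 := (hQ.pos r ⟨hr.1, hr.2.le⟩).ne'
  have h4 := hr.1.ne'
  rw [show (∫ s in (0 : ℝ)..r, Q s * g (w s)) = -(Q r * v r) by linarith]
  field_simp

/-- Serves the junction, where the shooting equations give no information: the derivative formula
extends there because its right-hand side is continuous. -/
theorem hasDerivAt_of_punctured {f g : ℝ → ℝ} {x : ℝ}
    (hd : ∀ᶠ y in 𝓝[≠] x, HasDerivAt f (g y) y) (hf : ContinuousAt f x) (hg : ContinuousAt g x) :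
    HasDerivAt f (g x) x := by
  have hr : ∀ᶠ y in 𝓝[>] x, HasDerivAt f (g y) y :=
    hd.filter_mono (nhdsWithin_mono x fun y (hy : y ∈ Ioi x) => ne_of_gt hy)
  have hl : ∀ᶠ y in 𝓝[<] x, HasDerivAt f (g y) y :=
    hd.filter_mono (nhdsWithin_mono x fun y (hy : y ∈ Iio x) => ne_of_lt hy)
  have h1 : HasDerivWithinAt f (g x) (Ici x) x :=
    hasDerivWithinAt_Ici_of_tendsto_deriv (s := {y | HasDerivAt f (g y) y})
      (fun y hy => (HasDerivAt.differentiableAt hy).differentiableWithinAt) hf.continuousWithinAt hr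
      ((hg.tendsto.mono_left nhdsWithin_le_nhds).congr' (hr.mono fun y hy => hy.deriv.symm))
  have h2 : HasDerivWithinAt f (g x) (Iic x) x :=
    hasDerivWithinAt_Iic_of_tendsto_deriv (s := {y | HasDerivAt f (g y) y})
      (fun y hy => (HasDerivAt.differentiableAt hy).differentiableWithinAt) hf.continuousWithinAt hl
      ((hg.tendsto.mono_left nhdsWithin_le_nhds).congr' (hl.mono fun y hy => hy.deriv.symm))
  simpa using h1.union h2

theorem contDiffOn_two_of_hasDerivWithinAt {f f' f'' : ℝ → ℝ} {c d : ℝ} (hcd : c < d)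
    (h1 : ∀ r ∈ Icc c d, HasDerivWithinAt f (f' r) (Icc c d) r)
    (h2 : ∀ r ∈ Icc c d, HasDerivWithinAt f' (f'' r) (Icc c d) r)
    (h3 : ContinuousOn f'' (Icc c d)) : ContDiffOn ℝ 2 f (Icc c d) := by
  have hu := uniqueDiffOn_Icc hcd
  rw [show (2 : WithTop ℕ∞) = 1 + 1 by norm_num, contDiffOn_succ_iff_derivWithin hu]
  refine ⟨fun r hr => (h1 r hr).differentiableWithinAt, by simp, ?_⟩
  have e : EqOn (derivWithin f (Icc c d)) f' (Icc c d) := fun r hr =>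
    (h1 r hr).derivWithin (hu r hr)
  refine ContDiffOn.congr ?_ e
  rw [show (1 : WithTop ℕ∞) = 0 + 1 by norm_num, contDiffOn_succ_iff_derivWithin hu]
  refine ⟨fun r hr => (h2 r hr).differentiableWithinAt, by simp, ?_⟩
  rw [contDiffOn_zero]
  exact h3.congr fun r hr => (h2 r hr).derivWithin (hu r hr)

/-- A continuous function differentiable on an open interval whose derivative has limits at the
end points is differentiable on the closed interval. -/
theorem hasDerivWithinAt_extendFrom {y y' : ℝ → ℝ} {A B c c' : ℝ} (hAB : A < B)
    (hy : Continuous y) (hd : ∀ r ∈ Ioo A B, HasDerivAt y (y' r) r)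
    (hc : Tendsto y' (𝓝[>] A) (𝓝 c)) (hc' : Tendsto y' (𝓝[<] B) (𝓝 c'))
    (hcont : ContinuousOn y' (Ioo A B)) {r : ℝ} (hr : r ∈ Icc A B) :
    HasDerivWithinAt y (extendFrom (Ioo A B) y' r) (Icc A B) r := by
  have hdiff : DifferentiableOn ℝ y (Ioo A B) := fun s hs =>
    (hd s hs).differentiableAt.differentiableWithinAt
  rcases hr.1.eq_or_lt with h0 | h0
  · rw [← h0, eq_lim_at_left_extendFrom_Ioo hAB hc]
    refine (hasDerivWithinAt_Ici_of_tendsto_deriv hdiff hy.continuousWithinAt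
      (Ioo_mem_nhdsGT hAB) (hc.congr' ?_)).mono Icc_subset_Ici_self
    filter_upwards [Ioo_mem_nhdsGT hAB] with s hs using (hd s hs).deriv.symm
  rcases hr.2.eq_or_lt with h1 | h1
  · rw [h1, eq_lim_at_right_extendFrom_Ioo hAB hc']
    refine (hasDerivWithinAt_Iic_of_tendsto_deriv hdiff hy.continuousWithinAt
      (Ioo_mem_nhdsLT hAB) (hc'.congr' ?_)).mono Icc_subset_Iic_self
    filter_upwards [Ioo_mem_nhdsLT hAB] with s hs using (hd s hs).deriv.symm
  · rw [extendFrom_extends hcont r ⟨h0, h1⟩]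
    exact (hd r ⟨h0, h1⟩).hasDerivWithinAt

/-- `w` is a `C¹` solution on `[0, π]` of the equation with coefficient `meanCurv a b`, with
derivative `v`, whose second derivative extends continuously to the end points. -/
structure FullSol (a b : ℕ) (p μ : ℝ) (w v : ℝ → ℝ) : Prop where
  cont : Continuous w
  cont' : Continuous v
  left : v 0 = 0
  right : v Real.pi = 0
  deriv : ∀ r ∈ Ioo 0 Real.pi, HasDerivAt w (v r) r
  deriv' : ∀ r ∈ Ioo 0 Real.pi,
    HasDerivAt v (-(meanCurv a b r * v r) - nonlin p μ (w r)) r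
  limit_left : ∃ l, Tendsto (fun r => -(meanCurv a b r * v r) - nonlin p μ (w r)) (𝓝[>] 0) (𝓝 l)
  limit_right : ∃ l,
    Tendsto (fun r => -(meanCurv a b r * v r) - nonlin p μ (w r)) (𝓝[<] Real.pi) (𝓝 l)

/-- Solutions shot from both end points that match can be glued. -/
theorem FullSol.glue (ha : 1 ≤ a) (hb : 1 ≤ b) (hp : 1 < p) {β : ℝ} {w₁ v₁ w₂ v₂ : ℝ → ℝ}
    (h₁ : ShootSol (meanCurv a b) (minimalAngle a b) (nonlin p μ) α w₁ v₁)
    (h₂ : ShootSol (meanCurv b a) (minimalAngle b a) (nonlin p μ) β w₂ v₂)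
    (hw : w₁ (minimalAngle a b) = w₂ (minimalAngle b a))
    (hv : v₁ (minimalAngle a b) = -v₂ (minimalAngle b a)) :
    ∃ w v : ℝ → ℝ, FullSol a b p μ w v ∧ EqOn w w₁ (Icc 0 (minimalAngle a b)) ∧
      ∀ r ∈ Icc 0 (minimalAngle b a), w (Real.pi - r) = w₂ r := by
  set m := minimalAngle a b with hmdef
  have hm : m ∈ Ioo 0 Real.pi := minimalAngle_mem ha hb
  have hm' : minimalAngle b a = Real.pi - m := minimalAngle_add ha hb
  have hg : Continuous (nonlin p μ) := continuous_nonlin hp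
  have hm0 := hm.1
  have hmp := hm.2
  rw [hm'] at hw hv ⊢
  set w : ℝ → ℝ := fun r => if r ≤ m then w₁ r else w₂ (Real.pi - r) with hwdef
  set v : ℝ → ℝ := fun r => if r ≤ m then v₁ r else -v₂ (Real.pi - r) with hvdef
  have hwl : ∀ r ≤ m, w r = w₁ r := fun r hr => if_pos hr
  have hvl : ∀ r ≤ m, v r = v₁ r := fun r hr => if_pos hr
  have hwr : ∀ r, m ≤ r → w r = w₂ (Real.pi - r) := by
    intro r hr
    rcases hr.eq_or_lt with rfl | h
    · rw [hwl _ le_rfl, hw]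
    · exact if_neg (not_le.2 h)
  have hvr : ∀ r, m ≤ r → v r = -v₂ (Real.pi - r) := by
    intro r hr
    rcases hr.eq_or_lt with rfl | h
    · rw [hvl _ le_rfl, hv]
    · exact if_neg (not_le.2 h)
  have hwc : Continuous w := Continuous.if_le h₁.cont (h₂.cont.comp (by fun_prop)) continuous_id
    continuous_const fun r hr => by rw [show r = m from hr, hw]
  have hvc : Continuous v := Continuous.if_le h₁.cont' (h₂.cont'.comp (by fun_prop)).neg
    continuous_id continuous_const fun r hr => by rw [show r = m from hr, hv]
  have hleft : ∀ r ∈ Ioo 0 m, HasDerivAt w (v r) r ∧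
      HasDerivAt v (-(meanCurv a b r * v r) - nonlin p μ (w r)) r := by
    intro r hr
    have h1 : w =ᶠ[𝓝 r] w₁ := by
      filter_upwards [Iio_mem_nhds hr.2] with s hs using hwl s (le_of_lt hs)
    have h2 : v =ᶠ[𝓝 r] v₁ := by
      filter_upwards [Iio_mem_nhds hr.2] with s hs using hvl s (le_of_lt hs)
    rw [hwl r hr.2.le, hvl r hr.2.le]
    exact ⟨(h₁.deriv r hr).congr_of_eventuallyEq h1, (h₁.deriv' r hr).congr_of_eventuallyEq h2⟩
  have hright : ∀ r ∈ Ioo m Real.pi, HasDerivAt w (v r) r ∧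
      HasDerivAt v (-(meanCurv a b r * v r) - nonlin p μ (w r)) r := by
    intro r hr
    have hr' : Real.pi - r ∈ Ioo 0 (minimalAngle b a) := by
      rw [hm']; exact ⟨by linarith [hr.2], by linarith [hr.1]⟩
    have h1 : w =ᶠ[𝓝 r] fun s => w₂ (Real.pi - s) := by
      filter_upwards [Ioi_mem_nhds hr.1] with s hs using hwr s (le_of_lt hs)
    have h2 : v =ᶠ[𝓝 r] fun s => -v₂ (Real.pi - s) := by
      filter_upwards [Ioi_mem_nhds hr.1] with s hs using hvr s (le_of_lt hs)
    rw [hwr r hr.1.le, hvr r hr.1.le]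
    constructor
    · exact ((h₂.deriv _ hr').comp_const_sub Real.pi r).congr_of_eventuallyEq h1
    · refine (((h₂.deriv' _ hr').comp_const_sub Real.pi r).neg.congr_of_eventuallyEq h2).congr_deriv ?_
      rw [meanCurv_reflect]
      ring
  have hpunct : ∀ᶠ r in 𝓝[≠] m, HasDerivAt w (v r) r ∧
      HasDerivAt v (-(meanCurv a b r * v r) - nonlin p μ (w r)) r := by
    filter_upwards [self_mem_nhdsWithin, mem_nhdsWithin_of_mem_nhds (Ioo_mem_nhds hm.1 hm.2)]
      with r hr hr'
    rcases lt_or_gt_of_ne (show r ≠ m from hr) with h | h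
    · exact hleft r ⟨hr'.1, h⟩
    · exact hright r ⟨h, hr'.2⟩
  have hall : ∀ r ∈ Ioo 0 Real.pi, HasDerivAt w (v r) r ∧
      HasDerivAt v (-(meanCurv a b r * v r) - nonlin p μ (w r)) r := by
    intro r hr
    rcases lt_trichotomy r m with h | rfl | h
    · exact hleft r ⟨hr.1, h⟩
    · refine ⟨hasDerivAt_of_punctured (hpunct.mono fun _ h => h.1) hwc.continuousAt
        hvc.continuousAt, hasDerivAt_of_punctured
        (g := fun r => -(meanCurv a b r * v r) - nonlin p μ (w r))
        (hpunct.mono fun _ h => h.2) hvc.continuousAt ?_⟩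
      exact (((continuousOn_meanCurv.continuousAt (Ioo_mem_nhds hr.1 hr.2)).mul
        hvc.continuousAt).neg).sub (hg.comp hwc).continuousAt
    · exact hright r ⟨h, hr.2⟩
  refine ⟨w, v, ⟨hwc, hvc, ?_, ?_, fun r hr => (hall r hr).1, fun r hr => (hall r hr).2, ?_, ?_⟩,
    fun r hr => hwl r hr.2, fun r hr => ?_⟩
  · rw [hvl 0 hm.1.le, h₁.init']
  · rw [hvr _ hm.2.le, sub_self, h₂.init', neg_zero]
  · refine ⟨_, (h₁.tendsto_deriv hg (isWeight_density ha hb)).congr' ?_⟩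
    filter_upwards [Ioo_mem_nhdsGT hm.1] with r hr
    rw [hwl r hr.2.le, hvl r hr.2.le]
  · have h3 : Tendsto (fun r => Real.pi - r) (𝓝[<] Real.pi) (𝓝[>] 0) := by
      refine tendsto_nhdsWithin_iff.2 ⟨?_, ?_⟩
      · have : Continuous fun r => Real.pi - r := by fun_prop
        have h := this.tendsto Real.pi
        rw [sub_self] at h
        exact h.mono_left nhdsWithin_le_nhds
      · filter_upwards [self_mem_nhdsWithin] with r hr using sub_pos.2 (mem_Iio.1 hr)
    refine ⟨_, ((h₂.tendsto_deriv hg (isWeight_density hb ha)).comp h3).congr' ?_⟩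
    filter_upwards [Ioo_mem_nhdsLT hm.2] with r hr
    simp only [Function.comp]
    rw [hwr r hr.1.le, hvr r hr.1.le, meanCurv_reflect]
    ring
  · rw [hwr _ (by linarith [hr.2]), sub_sub_cancel]

/-! ### Isolated zeros and critical points, and the passage to the original equation. -/

namespace FullSol

theorem exists_hasDerivWithinAt (h : FullSol a b p μ w v) (hp : 1 < p) :
    (∀ r ∈ Icc 0 Real.pi, HasDerivWithinAt w (v r) (Icc 0 Real.pi) r) ∧
      ContDiffOn ℝ 2 w (Icc 0 Real.pi) := by
  have hpi := Real.pi_pos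
  set f : ℝ → ℝ := fun r => -(meanCurv a b r * v r) - nonlin p μ (w r) with hf
  obtain ⟨l, hl⟩ := h.limit_left
  obtain ⟨l', hl'⟩ := h.limit_right
  have hfc : ContinuousOn f (Ioo 0 Real.pi) :=
    (continuousOn_meanCurv.mul h.cont'.continuousOn).neg.sub
      ((continuous_nonlin hp).comp h.cont).continuousOn
  have hv : ∀ r ∈ Icc 0 Real.pi, extendFrom (Ioo 0 Real.pi) v r = v r := by
    intro r hr
    exact extendFrom_eq (by rwa [closure_Ioo hpi.ne]) (h.cont'.continuousAt.tendsto.mono_left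
      nhdsWithin_le_nhds)
  have h1 : ∀ r ∈ Icc 0 Real.pi, HasDerivWithinAt w (v r) (Icc 0 Real.pi) r := by
    intro r hr
    have := hasDerivWithinAt_extendFrom hpi h.cont h.deriv (h.cont'.continuousAt.tendsto.mono_left nhdsWithin_le_nhds)
      (h.cont'.continuousAt.tendsto.mono_left nhdsWithin_le_nhds) h.cont'.continuousOn hr
    rwa [hv r hr] at this
  exact ⟨h1, contDiffOn_two_of_hasDerivWithinAt hpi h1
    (fun r hr => hasDerivWithinAt_extendFrom hpi h.cont' h.deriv' hl hl' hfc hr)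
    (continuousOn_Icc_extendFrom_Ioo hfc hl hl')⟩

theorem eq_const (h : FullSol a b p μ w v) (hp : 1 < p) (hμ : 0 < μ) {r e : ℝ}
    (hr : r ∈ Ioo 0 Real.pi) (he : nonlin p μ e = 0) (hw : w r = e) (hv : v r = 0) :
    ∀ s ∈ Icc 0 Real.pi, w s = e := by
  have hpi := Real.pi_pos
  have hopen : ∀ s ∈ Ioo 0 Real.pi, w s = e := by
    intro s hs
    have hsub : Icc (min r s) (max r s) ⊆ Ioo 0 Real.pi := fun t ht =>
      ⟨(lt_min hr.1 hs.1).trans_le ht.1, ht.2.trans_lt (max_lt hr.2 hs.2)⟩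
    obtain ⟨q₀, hq₀⟩ := isCompact_Icc.exists_bound_of_continuousOn
      ((continuousOn_meanCurv (a := a) (b := b)).mono hsub)
    have hmem : ∀ t ∈ Ioo (min r s) (max r s), t ∈ Ioo 0 Real.pi := fun t ht =>
      hsub ⟨ht.1.le, ht.2.le⟩
    exact (eq_const_of_touch hp hμ h.cont.continuousOn h.cont'.continuousOn
      (fun t ht => h.deriv t (hmem t ht)) (fun t ht => h.deriv' t (hmem t ht))
      (fun t ht => hq₀ t ⟨ht.1.le, ht.2.le⟩) he ⟨min_le_left _ _, le_max_left _ _⟩ hw hv s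
      ⟨min_le_right _ _, le_max_right _ _⟩).1
  have hcl : Icc 0 Real.pi ⊆ {s | w s = e} := by
    rw [← closure_Ioo hpi.ne]
    exact closure_minimal hopen (isClosed_eq h.cont continuous_const)
  exact hcl

/-- A double zero would force the zero solution by uniqueness, so the derivative is nonzero and the
zero is simple. -/
theorem isolated_zero (h : FullSol a b p μ w v) (hp : 1 < p) (hμ : 0 < μ)
    (hs : SignChanging w) {r : ℝ} (hr : r ∈ Ioo 0 Real.pi) (hw : w r = 0) :
    r ∈ isolatedPoints (zeroSet w) := by
  refine ⟨⟨⟨hr.1.le, hr.2.le⟩, hw⟩, ?_⟩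
  have hv : v r ≠ 0 := by
    intro hv
    obtain ⟨c, hc, hc'⟩ := hs.1
    exact hc'.ne' (h.eq_const hp hμ hr nonlin_zero hw hv c hc)
  rw [accPt_iff_frequently_nhdsNE, not_frequently]
  exact ((h.deriv r hr).eventually_ne hv).mono fun s hs hs' => hs hs'.2

/-- If `w''` vanished at a critical point, the value there would be an equilibrium and `w` would be
constant. Hence `w'' ≠ 0`, and `w'` has no other zero nearby. -/
theorem isolated_critical (h : FullSol a b p μ w v) (hp : 1 < p) (hμ : 0 < μ)
    (hs : SignChanging w) {r : ℝ} (hr : r ∈ Ioo 0 Real.pi) (hv : v r = 0) :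
    r ∈ isolatedPoints (criticalSet w) := by
  have hder := (h.exists_hasDerivWithinAt hp).1
  refine ⟨⟨⟨hr.1.le, hr.2.le⟩, by simpa [hv] using hder r ⟨hr.1.le, hr.2.le⟩⟩, ?_⟩
  have hne : nonlin p μ (w r) ≠ 0 := by
    intro he
    obtain ⟨⟨c, hc, hc'⟩, d, hd, hd'⟩ := hs
    rw [h.eq_const hp hμ hr he rfl hv c hc] at hc'
    rw [h.eq_const hp hμ hr he rfl hv d hd] at hd'
    exact lt_asymm hc' hd'
  have h1 : -(meanCurv a b r * v r) - nonlin p μ (w r) ≠ 0 := by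
    rw [hv]
    simpa using hne
  rw [accPt_iff_frequently_nhdsNE, not_frequently]
  refine ((h.deriv' r hr).eventually_ne (c := 0) h1).mono fun s hs hs' => hs ?_
  exact (uniqueDiffOn_Icc Real.pi_pos s hs'.1).eq_deriv _ (hder s hs'.1) hs'.2

theorem le_encard_zeros (h : FullSol a b p μ w v) (hp : 1 < p) (hμ : 0 < μ)
    (hs : SignChanging w) (Z : Finset ℝ) (hZ : ∀ r ∈ Z, r ∈ Ioo 0 Real.pi ∧ w r = 0) :
    (Z.card : ℕ∞) ≤ (isolatedPoints (zeroSet w)).encard := by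
  rw [← Set.encard_coe_eq_coe_finsetCard]
  exact encard_le_encard fun r hr => h.isolated_zero hp hμ hs (hZ r hr).1 (hZ r hr).2

/-- Rolle's theorem gives one critical point in each gap between consecutive zeros; the gaps are
disjoint. -/
theorem le_encard_critical (h : FullSol a b p μ w v) (hp : 1 < p) (hμ : 0 < μ)
    (hs : SignChanging w) {n : ℕ} (Z : Finset ℝ) (hZ : ∀ r ∈ Z, r ∈ Ioo 0 Real.pi ∧ w r = 0)
    (hn : Z.card = n + 1) : (n : ℕ∞) ≤ (isolatedPoints (criticalSet w)).encard := by
  set x := Z.orderEmbOfFin hn with hx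
  have hxZ : ∀ i, x i ∈ Z := fun i => Z.orderEmbOfFin_mem hn i
  have hex : ∀ i : Fin n, ∃ c ∈ Ioo (x i.castSucc) (x i.succ), v c = 0 := by
    intro i
    refine exists_hasDerivAt_eq_zero (f := w) (x.strictMono i.castSucc_lt_succ)
      h.cont.continuousOn ?_ fun s hs => h.deriv s
        ⟨(hZ _ (hxZ _)).1.1.trans hs.1, hs.2.trans (hZ _ (hxZ _)).1.2⟩
    rw [(hZ _ (hxZ _)).2, (hZ _ (hxZ _)).2]
  choose c hc hc' using hex
  have hmono : StrictMono c := by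
    intro i j hij
    exact (hc i).2.trans_le ((x.monotone (Fin.succ_le_castSucc_iff.2 hij)).trans (hc j).1.le)
  have hcard : (Finset.univ.map ⟨c, hmono.injective⟩).card = n := by simp
  rw [← hcard, ← Set.encard_coe_eq_coe_finsetCard]
  refine encard_le_encard fun r hr => ?_
  obtain ⟨i, -, rfl⟩ := Finset.mem_map.1 (Finset.mem_coe.1 hr)
  exact h.isolated_critical hp hμ hs
    ⟨(hZ _ (hxZ _)).1.1.trans (hc i).1, (hc i).2.trans (hZ _ (hxZ _)).1.2⟩ (hc' i)

end FullSol

theorem coeffH_div_sin {n ℓ mMinus mPlus : ℕ} (hn : 1 ≤ n) (hℓ : 1 ≤ ℓ)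
    (hmult : 2 * (n - 1) = ℓ * (mMinus + mPlus)) {r : ℝ} (hr : r ∈ Ioo 0 Real.pi) :
    coeffH n ℓ mMinus mPlus r / Real.sin r = meanCurv mMinus mPlus r := by
  have hs := (sin_half_pos hr).ne'
  have hc := (cos_half_pos hr).ne'
  have hℓ' : (ℓ : ℝ) ≠ 0 := by exact_mod_cast (by omega : ℓ ≠ 0)
  have h1 : ((n : ℝ) - 1) / ℓ = ((mMinus : ℝ) + mPlus) / 2 := by
    have h2 : (2 : ℝ) * ((n : ℝ) - 1) = ℓ * (mMinus + mPlus) := by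
      have := congrArg (Nat.cast (R := ℝ)) hmult
      push_cast [Nat.cast_sub hn] at this
      exact this
    field_simp
    linarith
  have h3 : Real.sin r = 2 * Real.sin (r / 2) * Real.cos (r / 2) := by
    rw [← Real.sin_two_mul]; ring_nf
  have h4 : Real.cos r = Real.cos (r / 2) ^ 2 - Real.sin (r / 2) ^ 2 := by
    rw [← Real.cos_two_mul']; ring_nf
  have h5 := Real.sin_sq_add_cos_sq (r / 2)
  rw [coeffH, h1, h3, h4, meanCurv]
  set s := Real.sin (r / 2)
  set c := Real.cos (r / 2)
  rw [div_eq_iff (by positivity)]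
  have e : (mMinus / 2 * (c / s) - mPlus / 2 * (s / c)) * (2 * s * c)
      = mMinus * c ^ 2 - mPlus * s ^ 2 := by field_simp
  rw [e]
  linear_combination (((mPlus : ℝ) - mMinus) / 2) * h5

theorem FullSol.isSolution {n ℓ mMinus mPlus : ℕ} (hn : 1 ≤ n) (hℓ : 1 ≤ ℓ)
    (hmult : 2 * (n - 1) = ℓ * (mMinus + mPlus)) {lam : ℝ} (hp : 1 < p)
    (h : FullSol mMinus mPlus p (lam / (ℓ : ℝ) ^ 2) w v) :
    IsSolution n ℓ mMinus mPlus lam p w := by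
  have hpi := Real.pi_pos
  obtain ⟨h1, h2⟩ := h.exists_hasDerivWithinAt hp
  refine ⟨h2, fun r hr => ?_, ?_, ?_⟩
  · have e : _root_.deriv w =ᶠ[𝓝 r] v := by
      filter_upwards [Ioo_mem_nhds hr.1 hr.2] with s hs using (h.deriv s hs).deriv
    rw [e.deriv_eq, (h.deriv r hr).deriv, (h.deriv' r hr).deriv, coeffH_div_sin hn hℓ hmult hr,
      nonlin]
    ring
  · simpa [h.left] using h1 0 (left_mem_Icc.2 hpi.le)
  · simpa [h.right] using h1 Real.pi (right_mem_Icc.2 hpi.le)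

/-- The conclusion is subcriticality in dimension `a + 1`, the effective dimension at the pole. The
critical exponent decreases with dimension, so a bound in dimension `N ≥ a + 1` suffices; for `a =
1` there is no restriction on `p`. -/
theorem subcritical_of_belowCritical {N a : ℕ} (ha : 1 ≤ a) (haN : a + 1 ≤ N) (hp : 1 < p)
    (h : BelowCriticalExponent N p) : ((a : ℝ) - 1) * p < a + 3 := by
  have ha' : (1 : ℝ) ≤ a := by exact_mod_cast ha
  have hN : (a : ℝ) + 1 ≤ N := by exact_mod_cast haN
  rcases ha.eq_or_lt with rfl | h1
  · norm_num
  · have h1' : (2 : ℝ) ≤ a := by exact_mod_cast h1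
    have h2 := h (by omega)
    rw [lt_div_iff₀ (by linarith)] at h2
    nlinarith

/-- The equation has sign-changing solutions with any number of zeros in the interior. -/
theorem exists_fullSol (ha : 1 ≤ a) (hb : 1 ≤ b) (hp : 1 < p) (hμ : 0 < μ)
    (hpa : ((a : ℝ) - 1) * p < a + 3) (hpb : ((b : ℝ) - 1) * p < b + 3) {K : ℕ} (hK : 1 ≤ K) :
    ∃ w v : ℝ → ℝ, FullSol a b p μ w v ∧ SignChanging w ∧
      ∃ Z : Finset ℝ, Z.card = K ∧ ∀ r ∈ Z, r ∈ Ioo 0 Real.pi ∧ w r = 0 := by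
  have hm := minimalAngle_mem ha hb
  have hm' := minimalAngle_mem hb ha
  have hQ : density a b (minimalAngle a b) = density b a (minimalAngle b a) := by
    rw [minimalAngle_add ha hb, density_reflect]
  obtain ⟨α, β, w₁, v₁, w₂, v₂, hα, -, h₁, h₂, hw, hv, hcase⟩ :=
    exists_matching (isWeight_density ha hb) (isWeight_density hb ha) hQ ha hb hp hμ hpa hpb hK
  obtain ⟨w, v, h, hl, hr⟩ := FullSol.glue ha hb hp h₁ h₂ hw hv
  have hpos : ∃ c ∈ Icc 0 Real.pi, 0 < w c :=
    ⟨0, left_mem_Icc.2 Real.pi_pos.le, by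
      rw [hl (left_mem_Icc.2 hm.1.le), h₁.init]; exact hα⟩
  refine ⟨w, v, h, ⟨hpos, ?_⟩, ?_⟩
  · rcases hcase with ⟨-, r, hr1, hr2⟩ | ⟨-, r, hr1, hr2⟩
    · exact ⟨r, ⟨hr1.1, hr1.2.trans hm.2.le⟩, by rwa [hl hr1]⟩
    · exact ⟨Real.pi - r, ⟨by linarith [hr1.2, hm'.2], by linarith [hr1.1]⟩, by rwa [hr r hr1]⟩
  · rcases hcase with ⟨⟨Z, hZ, hZ'⟩, -⟩ | ⟨⟨Z, hZ, hZ'⟩, -⟩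
    · refine ⟨Z, hZ, fun r hr => ⟨⟨(hZ' r hr).1.1, (hZ' r hr).1.2.trans hm.2⟩, ?_⟩⟩
      rw [hl ⟨(hZ' r hr).1.1.le, (hZ' r hr).1.2.le⟩, (hZ' r hr).2]
    · refine ⟨Z.map ⟨fun r => Real.pi - r, sub_right_injective⟩, by simpa using hZ, ?_⟩
      intro s hs
      obtain ⟨r, hrZ, rfl⟩ := Finset.mem_map.1 hs
      obtain ⟨h3, h4⟩ := hZ' r hrZ
      refine ⟨⟨?_, ?_⟩, ?_⟩
      · exact sub_pos.2 (h3.2.trans hm'.2)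
      · exact sub_lt_self _ h3.1
      · exact (hr r ⟨h3.1.le, h3.2.le⟩).trans h4

end NodalYamabe

theorem mainTheorem2 (n ℓ mMinus mPlus : ℕ)
    (hℓ : 1 ≤ ℓ)
    (hmMinus : 1 ≤ mMinus) (hmMinus' : mMinus ≤ n - 1)
    (hmPlus : 1 ≤ mPlus) (hmPlus' : mPlus ≤ n - 1)
    (hmult : 2 * (n - 1) = ℓ * (mMinus + mPlus))
    (lam : ℝ) (hlam : 0 < lam)
    (p : ℝ) (hp : 1 < p)
    (hpc : NodalYamabe.BelowCriticalExponent
      (n - min (NodalYamabe.focalDim n mMinus) (NodalYamabe.focalDim n mPlus)) p)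
    (k : ℕ) :
    ∃ w : ℝ → ℝ,
      NodalYamabe.IsSolution n ℓ mMinus mPlus lam p w ∧
      NodalYamabe.SignChanging w ∧
      (k : ℕ∞) ≤ (NodalYamabe.isolatedPoints (NodalYamabe.zeroSet w)).encard ∧
      ((k + 1 : ℕ) : ℕ∞) ≤ (NodalYamabe.isolatedPoints (NodalYamabe.criticalSet w)).encard := by
  have hμ : 0 < lam / (ℓ : ℝ) ^ 2 := by
    have : (0 : ℝ) < ℓ := by exact_mod_cast hℓ
    positivity
  -- The ambient dimension minus the smaller focal dimension is `max mMinus mPlus + 1`, so it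
  -- dominates the effective dimension at either pole.
  have hN₁ : mMinus + 1 ≤
      n - min (NodalYamabe.focalDim n mMinus) (NodalYamabe.focalDim n mPlus) := by
    simp only [NodalYamabe.focalDim]; omega
  have hN₂ : mPlus + 1 ≤
      n - min (NodalYamabe.focalDim n mMinus) (NodalYamabe.focalDim n mPlus) := by
    simp only [NodalYamabe.focalDim]; omega
  -- With `k + 2` interior zeros, Rolle's theorem already yields `k + 1` interior critical points,
  -- so isolation of the critical points at the poles is never needed.
  obtain ⟨w, v, h, hs, Z, hZ, hZ'⟩ := NodalYamabe.exists_fullSol hmMinus hmPlus hp hμ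
    (NodalYamabe.subcritical_of_belowCritical hmMinus hN₁ hp hpc)
    (NodalYamabe.subcritical_of_belowCritical hmPlus hN₂ hp hpc) (K := k + 2) (by omega)
  refine ⟨w, h.isSolution (by omega) hℓ hmult hp, hs, ?_,
    h.le_encard_critical hp hμ hs Z hZ' (by omega)⟩
  refine le_trans ?_ (h.le_encard_zeros hp hμ hs Z hZ')
  rw [hZ]
  exact_mod_cast (by omega : k ≤ k + 2)
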